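/- Let $\mu$ be a probability measure on $[0,1]$ with a density $f$ that is continuous on $[0,1]$, and let $q_1,q_2>0$ with $q_1+q_2<1$. For $n$ agents at $\vec x\in[0,1]^n$ and two facilities at $\vec y=(y_1,y_2)\in[0,1]^2$, each agent selects one of the facilities; of the agents that selected facility $j$, the $\lfloor q_jn\rfloor$ closest to $y_j$ (or all of them, if there are fewer) are accommodated, ties in distance being broken by an arbitrary fixed ranking of the agents (which may depend on $n$ and $j$). An accommodated agent at $x_i$ that selected facility $j$ gets utility $1-|x_i-y_j|$, every other agent gets $0$, and the Social Welfare of a strategy profile is the sum of the utilities. For $\vec p=(p_1,p_2)\in[0,1]^2$, the percentile mechanism $\mathcal{PM}_{\vec p}$ places facility $j$ at the position of the $(\lfloor p_j(n-1)\rfloor+1)$-th leftmost agent. It is *equilibrium-stable* if for every $n$ and every $\vec x\in[0,1]^n$ all pure Nash equilibria of the game with facilities at $\mathcal{PM}_{\vec p}(\vec x)$ have the same Social Welfare. It is *asymptotically optimal* if $$\lim_{n\to\infty}\frac{\mathbb E[SW_{opt}(\vec X_n)]}{\mathbb E[SW_{\vec p}(\vec X_n)]}=1,$$ where $\vec X_n$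 consists of $n$ independent agents with law $\mu$, $SW_{\vec p}(\vec x)$ is the (largest) equilibrium Social Welfare for the facilities at $\mathcal{PM}_{\vec p}(\vec x)$, and $SW_{opt}(\vec x)$ is the supremum, over $\vec y\in[0,1]^2$ and all pure Nash equilibria for $\vec y$, of the Social Welfare. Suppose that $f$ is monotone, i.e. strictly decreasing or strictly increasing on $[0,1]$, or single-peaked, i.e. for some $c\in[0,1]$ it is strictly increasing on $[0,c]$ and strictly decreasing on $[c,1]$. Then no percentile mechanism $\mathcal{PM}_{\vec p}$, $\vec p\in[0,1]^2$, is both equilibrium-stable and asymptotically optimal. -/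

import Mathlib

open MeasureTheory Filter Topology Set
open scoped ENNReal

namespace FLPSR

noncomputable section

/-! ### The First-Come-First-Served game

`n` agents sit at `x : Fin n → ℝ`, `m` facilities sit at `y : Fin m → ℝ`, and facility `j`
accommodates at most `⌊q j * n⌋` agents.  A strategy profile `s : Fin n → Fin m` tells which facility
each agent selects.  Agents at the same distance from facility `j` are ranked by the permutation
`tie j`. -/

/-- At facility `j`, agent `k` is served before agent `i`: `k` is closer to it, or they are equally
far from it and the tie-breaking rule of `j` puts `k` first. -/
def Precedes {n m : ℕ} (tie : Fin m → Equiv.Perm (Fin n)) (x : Fin n → ℝ) (y : Fin m → ℝ)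
    (j : Fin m) (k i : Fin n) : Prop :=
  |x k - y j| < |x i - y j| ∨ (|x k - y j| = |x i - y j| ∧ tie j k < tie j i)

/-- Agent `i` is among the first `⌊q j * n⌋` agents of those that selected the same facility
`j = s i`. -/
def Accommodated {n m : ℕ} (q : Fin m → ℝ) (tie : Fin m → Equiv.Perm (Fin n))
    (x : Fin n → ℝ) (y : Fin m → ℝ) (s : Fin n → Fin m) (i : Fin n) : Prop :=
  {k : Fin n | s k = s i ∧ Precedes tie x y (s i) k i}.ncard < ⌊q (s i) * (n : ℝ)⌋₊

open Classical in
/-- The utility of agent `i` under the strategy profile `s`. -/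
def utility {n m : ℕ} (q : Fin m → ℝ) (tie : Fin m → Equiv.Perm (Fin n))
    (x : Fin n → ℝ) (y : Fin m → ℝ) (s : Fin n → Fin m) (i : Fin n) : ℝ :=
  if Accommodated q tie x y s i then 1 - |x i - y (s i)| else 0

/-- Pure Nash equilibria of the First-Come-First-Served game. -/
def IsNash {n m : ℕ} (q : Fin m → ℝ) (tie : Fin m → Equiv.Perm (Fin n))
    (x : Fin n → ℝ) (y : Fin m → ℝ) (s : Fin n → Fin m) : Prop :=
  ∀ (i : Fin n) (j : Fin m),
    utility q tie x y (Function.update s i j) i ≤ utility q tie x y s i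

/-- The Social Welfare of the facility location `y` under the strategy profile `s`. -/
def socialWelfare {n m : ℕ} (q : Fin m → ℝ) (tie : Fin m → Equiv.Perm (Fin n))
    (x : Fin n → ℝ) (y : Fin m → ℝ) (s : Fin n → Fin m) : ℝ :=
  ∑ i, utility q tie x y s i

/-- The largest Social Welfare of the facility location `y` across all Nash equilibria.  When all
equilibria attain the same Social Welfare, this is the common value. -/
def nashWelfare {n m : ℕ} (q : Fin m → ℝ) (tie : Fin m → Equiv.Perm (Fin n))
    (x : Fin n → ℝ) (y : Fin m → ℝ) : ℝ≥0∞ :=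
  ⨆ (s : Fin n → Fin m) (_ : IsNash q tie x y s), ENNReal.ofReal (socialWelfare q tie x y s)

/-- The optimal Social Welfare of the instance `x`, over all facility locations in `[0,1]^m`. -/
def optWelfare {n m : ℕ} (q : Fin m → ℝ) (tie : Fin m → Equiv.Perm (Fin n))
    (x : Fin n → ℝ) : ℝ≥0∞ :=
  ⨆ (y : Fin m → ℝ) (_ : ∀ j, y j ∈ Icc (0 : ℝ) 1), nashWelfare q tie x y

/-! ### Percentile mechanisms -/

theorem percentile_index_lt {n : ℕ} (hn : 0 < n) {a : ℝ} (ha : a ∈ Icc (0 : ℝ) 1) :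
    ⌊a * ((n : ℝ) - 1)⌋₊ < n := by
  have h1 : (1 : ℝ) ≤ n := by exact_mod_cast hn
  have h0 : 0 ≤ a * ((n : ℝ) - 1) := mul_nonneg ha.1 (by linarith)
  rw [Nat.floor_lt h0]
  nlinarith [ha.2]

/-- The percentile mechanism: facility `j` is placed at the `⌊p j * (n - 1)⌋ + 1`-st leftmost agent.
(`Tuple.sort x` sorts `x` increasingly, counting from `0`; the default `0` is used only if there are
no agents or `p j ∉ [0,1]`.) -/
def percentileMechanism {n m : ℕ} (p : Fin m → ℝ) (x : Fin n → ℝ) : Fin m → ℝ := fun j =>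
  if h : ⌊p j * ((n : ℝ) - 1)⌋₊ < n then x (Tuple.sort x ⟨⌊p j * ((n : ℝ) - 1)⌋₊, h⟩) else 0

/-- For every number of agents and every input, all Nash equilibria induced by the output of the
percentile mechanism attain the same Social Welfare. -/
def IsEquilibriumStable {m : ℕ} (q : Fin m → ℝ) (tie : ∀ n : ℕ, Fin m → Equiv.Perm (Fin n))
    (p : Fin m → ℝ) : Prop :=
  ∀ (n : ℕ) (x : Fin n → ℝ), (∀ i, x i ∈ Icc (0 : ℝ) 1) →
    ∀ s s' : Fin n → Fin m,
      IsNash q (tie n) x (percentileMechanism p x) s →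
      IsNash q (tie n) x (percentileMechanism p x) s' →
      socialWelfare q (tie n) x (percentileMechanism p x) s =
        socialWelfare q (tie n) x (percentileMechanism p x) s'

/-- The Bayesian approximation ratio for `n` agents that are i.i.d. with law `μ`: the expected
optimal Social Welfare over the expected Social Welfare of the mechanism. -/
def bayesianRatio {m : ℕ} (μ : Measure ℝ) (q : Fin m → ℝ)
    (tie : ∀ n : ℕ, Fin m → Equiv.Perm (Fin n)) (p : Fin m → ℝ) (n : ℕ) : ℝ≥0∞ :=
  (∫⁻ x : Fin n → ℝ, optWelfare q (tie n) x ∂(Measure.pi fun _ => μ)) /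
    (∫⁻ x : Fin n → ℝ, nashWelfare q (tie n) x (percentileMechanism p x)
      ∂(Measure.pi fun _ => μ))

/-- The expected Social Welfare of the mechanism is optimal as the number of agents increases. -/
def IsAsymptoticallyOptimal {m : ℕ} (μ : Measure ℝ) (q : Fin m → ℝ)
    (tie : ∀ n : ℕ, Fin m → Equiv.Perm (Fin n)) (p : Fin m → ℝ) : Prop :=
  Tendsto (bayesianRatio μ q tie p) atTop (𝓝 1)

/-! ### Distributions on `[0,1]` -/

/-- `μ` is the probability measure on `[0,1]` with the continuous density `f`. -/
structure HasContinuousDensity (μ : Measure ℝ) (f : ℝ → ℝ) : Prop where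
  isProbabilityMeasure : IsProbabilityMeasure μ
  continuousOn : ContinuousOn f (Icc 0 1)
  nonneg : ∀ x ∈ Icc (0 : ℝ) 1, 0 ≤ f x
  eq_withDensity : μ = (volume.restrict (Icc 0 1)).withDensity fun x => ENNReal.ofReal (f x)

/-- The density is strictly decreasing or strictly increasing on `[0,1]`. -/
def IsMonotoneDensity (f : ℝ → ℝ) : Prop :=
  StrictAntiOn f (Icc 0 1) ∨ StrictMonoOn f (Icc 0 1)

/-- The density strictly increases up to a peak and strictly decreases after it. -/
def IsSinglePeakedDensity (f : ℝ → ℝ) : Prop :=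
  ∃ c ∈ Icc (0 : ℝ) 1, StrictMonoOn f (Icc 0 c) ∧ StrictAntiOn f (Icc c 1)

end

end FLPSR

/-! Label the facilities so that `p a ≤ p b`. About `(p b - p a) * n` agents lie between them,
against a total capacity of about `(q a + q b) * n`, and each of the three possible regimes defeats
one of the two properties.

If `0 < p b - p a < q a + q b`, both facilities have places left after serving the agents between
them. Put one agent exactly midway. Whichever facility it selects, the other one keeps one more
place for outer agents; positions are chosen so that a place at `a` and a place at `b` have
different values to the outer agents. This gives two equilibria of different welfare
(`not_isEquilibriumStable_of_lt`).

In the other two regimes a small displacement of one facility gains a fixed multiple of `n`. It is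
enough to see this on typical samples, those whose empirical distribution is uniformly close to `μ`:
they have probability at least `1/2` for large `n` by Chebyshev's inequality on a finite grid. As
the welfare never exceeds `n`, a linear gain keeps the ratio away from `1`
(`not_isAsymptoticallyOptimal_of_gain`).

If `p a = p b`, the facilities coincide. Move one of them by `ε` towards the side holding at least
half of the served agents. Almost the same agents are served afterwards, and those of the moved
facility lie mostly on its new side, so the gain is of order `ε * n` (`le_welfare_of_split`).

If `p b - p a ≥ q a + q b`, let `α < β` be the quantiles, and take the balls around them of mass `q
a` and `q b`. These are separated (`balls_separated`), so the facilities do not compete and each can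
be moved slightly on its own. One of the two balls lies, within `[0,1]`, on the outer side of the
peak, where the density strictly increases towards the other facility. Its inner half is then the
heavier one, and moving its center inwards pays (`not_isAsymptoticallyOptimal_of_unbalanced`).

Equilibria are handled through stable assignments: each one is realized by an equilibrium, which
bounds the optimum from below, while upper bounds for the mechanism use only that the served sets
are disjoint and respect the capacities. -/

namespace FLPSR

section Game

variable {n m : ℕ} {q : Fin m → ℝ} {tie : Fin m → Equiv.Perm (Fin n)} {x : Fin n → ℝ}
  {y : Fin m → ℝ}

/-! ### The order in which a facility serves the agents -/

/-- The position of agent `i` in the queue of facility `j`, as an element of a linear order. -/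
noncomputable def queueKey (tie : Fin m → Equiv.Perm (Fin n)) (x : Fin n → ℝ) (y : Fin m → ℝ)
    (j : Fin m) (i : Fin n) : Lex (ℝ × Fin n) :=
  toLex (|x i - y j|, tie j i)

/-- Distance with ties broken by rank is a lexicographic order, so the service order is a strict
linear order and finite sets of agents have first and last elements. -/
theorem precedes_iff_queueKey_lt {j : Fin m} {k i : Fin n} :
    Precedes tie x y j k i ↔ queueKey tie x y j k < queueKey tie x y j i := by
  simp [Precedes, queueKey, Prod.Lex.toLex_lt_toLex]

theorem queueKey_injective (j : Fin m) : Function.Injective (queueKey tie x y j) := by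
  intro a b h
  have h' : (|x a - y j|, tie j a) = (|x b - y j|, tie j b) := toLex.injective h
  exact (tie j).injective (Prod.ext_iff.1 h').2

theorem Precedes.asymm {j : Fin m} {k i : Fin n} (h : Precedes tie x y j k i) :
    ¬ Precedes tie x y j i k := by
  rw [precedes_iff_queueKey_lt] at *
  exact h.asymm

theorem Precedes.ne {j : Fin m} {k i : Fin n} (h : Precedes tie x y j k i) : k ≠ i := by
  rintro rfl
  exact h.asymm h

theorem precedes_of_not_precedes {j : Fin m} {k i : Fin n} (hki : k ≠ i)
    (h : ¬ Precedes tie x y j k i) : Precedes tie x y j i k := by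
  rw [precedes_iff_queueKey_lt] at *
  exact lt_of_le_of_ne (not_lt.1 h) fun h' => hki (queueKey_injective j h').symm

theorem Precedes.dist_le {j : Fin m} {k i : Fin n} (h : Precedes tie x y j k i) :
    |x k - y j| ≤ |x i - y j| := by
  rcases h with h | h
  · exact h.le
  · exact h.1.le

theorem precedes_of_dist_lt {j : Fin m} {k i : Fin n} (h : |x k - y j| < |x i - y j|) :
    Precedes tie x y j k i := Or.inl h

/-- Every finite set of agents contains the `c` agents that facility `j` serves first. -/
theorem exists_first_subset (tie : Fin m → Equiv.Perm (Fin n)) (x : Fin n → ℝ) (y : Fin m → ℝ)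
    (j : Fin m) (B : Finset (Fin n)) {c : ℕ} (hc : c ≤ B.card) :
    ∃ S ⊆ B, S.card = c ∧ ∀ a ∈ S, ∀ b ∈ B, b ∉ S → Precedes tie x y j a b := by
  induction c with
  | zero => exact ⟨∅, by simp, by simp, by simp⟩
  | succ c ih =>
    obtain ⟨S, hSB, hSc, hS⟩ := ih (by omega)
    have hne : (B \ S).Nonempty := by
      rw [← Finset.card_pos, Finset.card_sdiff_of_subset hSB]
      omega
    obtain ⟨a, ha, hmin⟩ := Finset.exists_min_image (B \ S) (queueKey tie x y j) hne
    rw [Finset.mem_sdiff] at ha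
    refine ⟨insert a S, Finset.insert_subset ha.1 hSB, ?_, ?_⟩
    · rw [Finset.card_insert_of_notMem ha.2, hSc]
    · intro b hb d hd hdS
      rw [Finset.mem_insert, not_or] at hdS
      rcases Finset.mem_insert.1 hb with rfl | hb
      · rw [precedes_iff_queueKey_lt]
        refine lt_of_le_of_ne (hmin d (Finset.mem_sdiff.2 ⟨hd, hdS.2⟩)) fun h => hdS.1 ?_
        exact (queueKey_injective j h).symm
      · exact hS b hb d hd hdS.2

/-- Of all sets with at most `S.card` elements, a set of elements of largest weight has the largest
total weight. -/
theorem sum_le_sum_of_dominates {ι : Type*} [DecidableEq ι] {w : ι → ℝ} {S T : Finset ι}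
    (hw : ∀ i ∈ S, 0 ≤ w i) (hST : ∀ a ∈ S, ∀ b ∈ T, b ∉ S → w b ≤ w a) (hcard : T.card ≤ S.card) :
    ∑ i ∈ T, w i ≤ ∑ i ∈ S, w i := by
  rw [← Finset.sum_inter_add_sum_sdiff S T w, ← Finset.sum_inter_add_sum_sdiff T S w,
    Finset.inter_comm T S]
  gcongr _ + ?_
  have hc : (T \ S).card ≤ (S \ T).card := by
    have h1 := Finset.card_sdiff_add_card_inter T S
    have h2 := Finset.card_sdiff_add_card_inter S T
    rw [Finset.inter_comm] at h2
    omega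
  rcases (T \ S).eq_empty_or_nonempty with h | h
  · rw [h, Finset.sum_empty]
    exact Finset.sum_nonneg fun i hi => hw i (Finset.mem_sdiff.1 hi).1
  -- The weight of `b` separates the weights on `T \ S` from those on `S \ T`. If it is negative,
  -- the sign condition on `S` alone is enough.
  · obtain ⟨b, hb, hmax⟩ := Finset.exists_max_image (T \ S) w h
    have hpos : 0 < (S \ T).card := lt_of_lt_of_le (Finset.card_pos.2 h) hc
    have hb' := Finset.mem_sdiff.1 hb
    have h1 : ∑ i ∈ T \ S, w i ≤ (T \ S).card • w b := Finset.sum_le_card_nsmul _ _ _ hmax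
    by_cases hwb : 0 ≤ w b
    · have h2 : (S \ T).card • w b ≤ ∑ i ∈ S \ T, w i := Finset.card_nsmul_le_sum _ _ _
        fun i hi => hST i (Finset.mem_sdiff.1 hi).1 b hb'.1 hb'.2
      exact h1.trans ((nsmul_le_nsmul_left hwb hc).trans h2)
    · have h2 : ∑ i ∈ T \ S, w i ≤ 0 :=
        Finset.sum_nonpos fun i hi => (hmax i hi).trans (not_le.1 hwb).le
      exact h2.trans (Finset.sum_nonneg fun i hi => hw i (Finset.mem_sdiff.1 hi).1)

/-! ### Stable assignments -/

/-- The agents of `A j` are served by facility `j`, and no agent would rather be served by another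
facility that has a free place or would prefer this agent to one of those it serves. -/
structure IsStableAssignment (q : Fin m → ℝ) (tie : Fin m → Equiv.Perm (Fin n))
    (x : Fin n → ℝ) (y : Fin m → ℝ) (A : Fin m → Finset (Fin n)) : Prop where
  disjoint : ∀ j k, j ≠ k → Disjoint (A j) (A k)
  card_le : ∀ j, (A j).card ≤ ⌊q j * (n : ℝ)⌋₊
  blocked_or : ∀ j, ∀ i ∉ A j,
    ((A j).card = ⌊q j * (n : ℝ)⌋₊ ∧ ∀ a ∈ A j, Precedes tie x y j a i) ∨
      ∃ k, i ∈ A k ∧ |x i - y k| ≤ |x i - y j|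

theorem utility_nonneg (h1 : ∀ i j, |x i - y j| ≤ 1) (s : Fin n → Fin m) (i : Fin n) :
    0 ≤ utility q tie x y s i := by
  unfold utility
  split_ifs
  · linarith [h1 i (s i)]
  · rfl

/-- A stable assignment is the set of the accommodated agents of a Nash equilibrium. -/
theorem IsStableAssignment.exists_isNash [NeZero m] {A : Fin m → Finset (Fin n)}
    (hA : IsStableAssignment q tie x y A) (h1 : ∀ i j, |x i - y j| ≤ 1) :
    ∃ s, IsNash q tie x y s ∧
      socialWelfare q tie x y s = ∑ j, ∑ i ∈ A j, (1 - |x i - y j|) := by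
  classical
  have huniq : ∀ {i j k}, i ∈ A j → i ∈ A k → j = k := by
    intro i j k hj hk
    by_contra hne
    exact Finset.disjoint_left.1 (hA.disjoint j k hne) hj hk
  obtain ⟨s, hs⟩ : ∃ s : Fin n → Fin m, ∀ i j, i ∈ A j → s i = j := by
    -- The choice `0` for unserved agents is arbitrary: every facility is full of agents that
    -- precede them.
    refine ⟨fun i => if h : ∃ j, i ∈ A j then h.choose else 0, fun i j hij => ?_⟩
    have h : ∃ j, i ∈ A j := ⟨j, hij⟩
    simp only [dif_pos h]
    exact huniq h.choose_spec hij
  have hunserved : ∀ i j, (∀ k, i ∉ A k) →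
      (A j).card = ⌊q j * (n : ℝ)⌋₊ ∧ ∀ a ∈ A j, Precedes tie x y j a i := by
    intro i j hi
    rcases hA.blocked_or j i (hi j) with h | ⟨k, hk, -⟩
    · exact h
    · exact absurd hk (hi k)
  have hacc : ∀ i, Accommodated q tie x y s i ↔ i ∈ A (s i) := by
    intro i
    unfold Accommodated
    constructor
    · intro h
      by_contra hi
      have hi' : ∀ k, i ∉ A k := fun k hk => hi (by rwa [hs i k hk])
      obtain ⟨hc, hp⟩ := hunserved i (s i) hi'
      rw [← hc, ← Set.ncard_coe_finset] at h
      refine absurd h (not_lt.2 (Set.ncard_le_ncard (fun a ha => ?_) (Set.toFinite _)))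
      exact ⟨hs a _ ha, hp a ha⟩
    · intro hi
      refine lt_of_lt_of_le (lt_of_le_of_lt (b := ((A (s i)).erase i).card) ?_
        (Finset.card_erase_lt_of_mem hi)) (hA.card_le (s i))
      rw [← Set.ncard_coe_finset]
      refine Set.ncard_le_ncard (fun a ha => ?_) (Set.toFinite _)
      obtain ⟨ha1, ha2⟩ := ha
      rw [Finset.mem_coe, Finset.mem_erase]
      refine ⟨ha2.ne, ?_⟩
      by_contra hai
      have ha' : ∀ k, a ∉ A k := fun k hk => hai (by rwa [← ha1, hs a k hk])
      exact ((hunserved a (s i) ha').2 i hi).asymm ha2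
  refine ⟨s, ?_, ?_⟩
  · intro i j
    by_cases hij : i ∈ A j
    · have : Function.update s i j = s := by
        rw [← hs i j hij, Function.update_eq_self]
      rw [this]
    · rcases hA.blocked_or j i hij with ⟨hc, hp⟩ | ⟨k, hk, hd⟩
      · have : ¬ Accommodated q tie x y (Function.update s i j) i := by
          unfold Accommodated
          simp only [Function.update_self]
          rw [not_lt, ← hc, ← Set.ncard_coe_finset]
          refine Set.ncard_le_ncard (fun a ha => ?_) (Set.toFinite _)
          have hai : a ≠ i := (hp a ha).ne
          exact ⟨by rw [Function.update_of_ne hai, hs a j ha], hp a ha⟩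
        have h0 : utility q tie x y (Function.update s i j) i = 0 := if_neg this
        rw [h0]
        exact utility_nonneg h1 s i
      · have hsi := hs i k hk
        have h2 : utility q tie x y s i = 1 - |x i - y k| := by
          unfold utility
          rw [if_pos ((hacc i).2 (by rwa [hsi])), hsi]
        rw [h2]
        unfold utility
        split_ifs
        · simp only [Function.update_self]
          linarith
        · linarith [h1 i k]
  · unfold socialWelfare
    have h3 : ∀ j, ∑ i ∈ A j, (1 - |x i - y j|)
        = ∑ i, if s i = j then utility q tie x y s i else 0 := by
      intro j
      rw [← Finset.sum_filter]
      have hsub : A j ⊆ Finset.univ.filter fun i => s i = j := fun i hi => by simp [hs i j hi]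
      rw [← Finset.sum_subset hsub (f := fun i => utility q tie x y s i)]
      · refine Finset.sum_congr rfl fun i hi => ?_
        have hsi := hs i j hi
        unfold utility
        rw [if_pos ((hacc i).2 (by rwa [hsi])), hsi]
      · intro i hi hij
        have hsi : s i = j := by simpa using hi
        exact if_neg fun h => hij (by rw [← hsi]; exact (hacc i).1 h)
    simp_rw [h3]
    rw [Finset.sum_comm]
    simp

/-- The accommodated agents of a strategy profile. -/
theorem exists_served_sets (q : Fin m → ℝ) (tie : Fin m → Equiv.Perm (Fin n)) (x : Fin n → ℝ)
    (y : Fin m → ℝ) (s : Fin n → Fin m) :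
    ∃ A : Fin m → Finset (Fin n), (∀ j k, j ≠ k → Disjoint (A j) (A k)) ∧
      (∀ j, (A j).card ≤ ⌊q j * (n : ℝ)⌋₊) ∧
      socialWelfare q tie x y s = ∑ j, ∑ i ∈ A j, (1 - |x i - y j|) := by
  classical
  refine ⟨fun j => Finset.univ.filter fun i => s i = j ∧ Accommodated q tie x y s i, ?_, ?_, ?_⟩
  · intro j k hjk
    rw [Finset.disjoint_left]
    intro i hi hi'
    simp only [Finset.mem_filter, Finset.mem_univ, true_and] at hi hi'
    exact hjk (hi.1.symm.trans hi'.1)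
  · intro j
    change (Finset.univ.filter fun i => s i = j ∧ Accommodated q tie x y s i).card ≤ _
    set B := Finset.univ.filter fun i => s i = j ∧ Accommodated q tie x y s i with hB
    rcases B.eq_empty_or_nonempty with h | h
    · simp [h]
    -- All other accommodated agents of `j` precede the last one, whose own accommodation bounds
    -- their number.
    · obtain ⟨i, hi, hmax⟩ := Finset.exists_max_image B (queueKey tie x y j) h
      have hi' : s i = j ∧ Accommodated q tie x y s i := by simpa [hB] using hi
      have hacc := hi'.2
      unfold Accommodated at hacc
      rw [hi'.1] at hacc
      have h2 : (B.erase i).card ≤ {k : Fin n | s k = j ∧ Precedes tie x y j k i}.ncard := by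
        rw [← Set.ncard_coe_finset]
        refine Set.ncard_le_ncard (fun a ha => ?_) (Set.toFinite _)
        rw [Finset.mem_coe, Finset.mem_erase] at ha
        have ha' : s a = j ∧ Accommodated q tie x y s a := by simpa [hB] using ha.2
        refine ⟨ha'.1, precedes_iff_queueKey_lt.2 (lt_of_le_of_ne (hmax a ha.2) fun h => ha.1 ?_)⟩
        exact queueKey_injective j h
      rw [Finset.card_erase_of_mem hi] at h2
      omega
  · unfold socialWelfare
    have h3 : ∀ j, ∑ i ∈ Finset.univ.filter (fun i => s i = j ∧ Accommodated q tie x y s i),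
        (1 - |x i - y j|) = ∑ i, if s i = j then utility q tie x y s i else 0 := by
      intro j
      rw [Finset.sum_filter]
      refine Finset.sum_congr rfl fun i _ => ?_
      unfold utility
      by_cases h : s i = j <;> by_cases h' : Accommodated q tie x y s i <;> simp [h, h']
    simp_rw [h3]
    rw [Finset.sum_comm]
    simp

/-- Stable assignments exist: assign greedily, starting from the closest pairs of an agent and a
facility. -/
theorem exists_isStableAssignment (q : Fin m → ℝ) (tie : Fin m → Equiv.Perm (Fin n))
    (x : Fin n → ℝ) (y : Fin m → ℝ) : ∃ A, IsStableAssignment q tie x y A := by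
  classical
  let key : Fin n × Fin m → Lex (ℝ × Fin n) := fun a => queueKey tie x y a.2 a.1
  let rank : Fin n × Fin m → ℕ := fun a => (Finset.univ.filter fun b => key a < key b).card
  have hrank : ∀ {a b}, key a < key b → rank b < rank a := by
    intro a b hab
    refine Finset.card_lt_card (Finset.ssubset_iff_of_subset ?_ |>.2 ⟨b, by simpa using hab, by simp⟩)
    intro c hc
    simp only [Finset.mem_filter, Finset.mem_univ, true_and] at hc ⊢
    exact hab.trans hc
  -- The greedy choice is encoded as a maximum weight problem: a pair outweighs any two pairs with
  -- strictly larger keys. A blocking pair would displace at most two such pairs, one of its agent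
  -- and one of its facility, and so increase the total weight.
  let w : Fin n × Fin m → ℕ := fun a => 3 ^ rank a
  have hwpos : ∀ a, 0 < w a := fun a => by positivity
  have hw : ∀ {a b}, key a < key b → 3 * w b ≤ w a := by
    intro a b hab
    calc 3 * w b = 3 ^ (rank b + 1) := by simp only [w]; ring
      _ ≤ w a := Nat.pow_le_pow_right (by norm_num) (hrank hab)
  let P : Finset (Finset (Fin n × Fin m)) := Finset.univ.filter fun E =>
    (∀ a ∈ E, ∀ b ∈ E, a.1 = b.1 → a = b) ∧
      ∀ j, (E.filter fun a => a.2 = j).card ≤ ⌊q j * (n : ℝ)⌋₊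
  have hP : P.Nonempty := ⟨∅, by simp [P]⟩
  obtain ⟨E, hE, hmax⟩ := Finset.exists_max_image P (fun E => ∑ a ∈ E, w a) hP
  simp only [P, Finset.mem_filter, Finset.mem_univ, true_and] at hE hmax
  obtain ⟨hE1, hE2⟩ := hE
  have himage : ∀ j, ((E.filter fun a => a.2 = j).image Prod.fst).card
      = (E.filter fun a => a.2 = j).card := by
    intro j
    refine Finset.card_image_of_injOn fun a ha b hb hab => ?_
    rw [Finset.mem_coe, Finset.mem_filter] at ha hb
    exact hE1 a ha.1 b hb.1 hab
  have hmem : ∀ i j, i ∈ (E.filter fun a => a.2 = j).image Prod.fst ↔ (i, j) ∈ E := by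
    intro i j
    simp only [Finset.mem_image, Finset.mem_filter, Prod.exists, exists_and_right, exists_eq_right]
  refine ⟨fun j => (E.filter fun a => a.2 = j).image Prod.fst, ?_, ?_, ?_⟩
  · intro j k hjk
    rw [Finset.disjoint_left]
    intro i hi hi'
    rw [hmem] at hi hi'
    exact hjk (congrArg Prod.snd (hE1 _ hi _ hi' rfl))
  · intro j
    rw [himage]
    exact hE2 j
  · intro j i hij
    rw [hmem] at hij
    by_contra! hcon
    obtain ⟨hnb, hfar⟩ := hcon
    simp only [hmem] at hfar
    rw [himage] at hnb
    -- the pair `(i, j)` replaces the old pair of `i` and, if `j` is full, a pair of `j`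
    obtain ⟨D, hDE, hDcard, hDsum⟩ : ∃ D ⊆ E.filter (fun a => a.2 = j),
        (E.filter fun a => a.2 = j).card + 1 ≤ ⌊q j * (n : ℝ)⌋₊ + D.card ∧
        3 * ∑ a ∈ D, w a ≤ w (i, j) := by
      by_cases hc : (E.filter fun a => a.2 = j).card = ⌊q j * (n : ℝ)⌋₊
      · obtain ⟨a, ha, hai⟩ := hnb hc
        rw [hmem] at ha
        refine ⟨{(a, j)}, by simpa using ha, by simp [hc], ?_⟩
        rw [Finset.sum_singleton]
        refine hw (precedes_iff_queueKey_lt.1 (precedes_of_not_precedes ?_ hai))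
        rintro rfl
        exact hij ha
      · exact ⟨∅, by simp, by have := hE2 j; simp; omega, by simp⟩
    let O := E.filter fun a => a.1 = i
    have hO : 3 * ∑ a ∈ O, w a ≤ w (i, j) := by
      rcases O.eq_empty_or_nonempty with h | ⟨b, hb⟩
      · simp [h]
      · have hOb : O = {b} := by
          refine Finset.eq_singleton_iff_unique_mem.2 ⟨hb, fun c hc => ?_⟩
          simp only [O, Finset.mem_filter] at hb hc
          exact hE1 c hc.1 b hb.1 (hc.2.trans hb.2.symm)
        rw [hOb, Finset.sum_singleton]
        simp only [O, Finset.mem_filter] at hb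
        obtain ⟨hbE, rfl⟩ := hb
        refine hw ?_
        have := hfar b.2 hbE
        simp only [key, queueKey, Prod.Lex.toLex_lt_toLex]
        exact Or.inl this
    have hnot : (i, j) ∉ E \ (D ∪ O) := fun h => hij (Finset.mem_sdiff.1 h).1
    have hDE' : D ⊆ E := hDE.trans (Finset.filter_subset _ _)
    have hOE : O ⊆ E := Finset.filter_subset _ _
    have hnew := hmax (insert (i, j) (E \ (D ∪ O))) ?_
    · rw [Finset.sum_insert hnot] at hnew
      have h1 := Finset.sum_sdiff (f := w) (Finset.union_subset hDE' hOE)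
      have h2 := Finset.sum_union_inter (s₁ := D) (s₂ := O) (f := w)
      have := hwpos (i, j)
      omega
    · constructor
      · intro a ha b hb hab
        rw [Finset.mem_insert, Finset.mem_sdiff, Finset.mem_union, not_or] at ha hb
        rcases ha with rfl | ha <;> rcases hb with rfl | hb
        · rfl
        · exact absurd (Finset.mem_filter.2 ⟨hb.1, hab.symm⟩) hb.2.2
        · exact absurd (Finset.mem_filter.2 ⟨ha.1, hab⟩) ha.2.2
        · exact hE1 a ha.1 b hb.1 hab
      · intro k
        rw [Finset.filter_insert]
        split_ifs with hk
        · simp only at hk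
          subst hk
          have hsub : (E \ (D ∪ O)).filter (fun a => a.2 = j) ⊆ (E.filter fun a => a.2 = j) \ D := by
            intro a ha
            simp only [Finset.mem_filter, Finset.mem_sdiff, Finset.mem_union, not_or] at ha ⊢
            tauto
          have h3 := Finset.card_le_card hsub
          rw [Finset.card_sdiff_of_subset hDE] at h3
          have h4 := Finset.card_insert_le (i, j) ((E \ (D ∪ O)).filter fun a => a.2 = j)
          have h5 := Finset.card_le_card hDE
          omega
        · exact (Finset.card_le_card (Finset.filter_subset_filter _ Finset.sdiff_subset)).trans
            (hE2 k)

/-! ### Bounds for the Social Welfare -/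

theorem IsStableAssignment.le_nashWelfare [NeZero m] {A : Fin m → Finset (Fin n)}
    (hA : IsStableAssignment q tie x y A) (h1 : ∀ i j, |x i - y j| ≤ 1) :
    ENNReal.ofReal (∑ j, ∑ i ∈ A j, (1 - |x i - y j|)) ≤ nashWelfare q tie x y := by
  obtain ⟨s, hs, hsw⟩ := hA.exists_isNash h1
  rw [← hsw]
  exact le_iSup₂ (f := fun s (_ : IsNash q tie x y s) =>
    ENNReal.ofReal (socialWelfare q tie x y s)) s hs

theorem nashWelfare_le_optWelfare (hy : ∀ j, y j ∈ Icc (0 : ℝ) 1) :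
    nashWelfare q tie x y ≤ optWelfare q tie x :=
  le_iSup₂ (f := fun (y : Fin m → ℝ) (_ : ∀ j, y j ∈ Icc (0 : ℝ) 1) => nashWelfare q tie x y) y hy

/-- The equilibrium condition is discarded here: the bound is a relaxation to arbitrary disjoint
served sets within the capacities. -/
theorem nashWelfare_le_ofReal {W : ℝ}
    (h : ∀ A : Fin m → Finset (Fin n), (∀ j k, j ≠ k → Disjoint (A j) (A k)) →
      (∀ j, (A j).card ≤ ⌊q j * (n : ℝ)⌋₊) → ∑ j, ∑ i ∈ A j, (1 - |x i - y j|) ≤ W) :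
    nashWelfare q tie x y ≤ ENNReal.ofReal W := by
  refine iSup₂_le fun s _ => ENNReal.ofReal_le_ofReal ?_
  obtain ⟨A, hA1, hA2, hA3⟩ := exists_served_sets q tie x y s
  rw [hA3]
  exact h A hA1 hA2

/-- This makes the expected welfare finite and turns an additive gain linear in `n` into a
multiplicative one. -/
theorem nashWelfare_le_card : nashWelfare q tie x y ≤ n := by
  refine iSup₂_le fun s _ => ?_
  rw [← ENNReal.ofReal_natCast]
  refine ENNReal.ofReal_le_ofReal ?_
  calc socialWelfare q tie x y s ≤ ∑ _i : Fin n, (1 : ℝ) := by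
        refine Finset.sum_le_sum fun i _ => ?_
        unfold utility
        split_ifs
        · linarith [abs_nonneg (x i - y (s i))]
        · exact zero_le_one
    _ = n := by simp

end Game

theorem abs_sub_le_one_of_mem_Icc {a b : ℝ} (ha : a ∈ Icc (0 : ℝ) 1) (hb : b ∈ Icc (0 : ℝ) 1) :
    |a - b| ≤ 1 := by
  rw [abs_le]
  constructor <;> linarith [ha.1, ha.2, hb.1, hb.2]

theorem percentileMechanism_mem_Icc {n m : ℕ} {p : Fin m → ℝ} {x : Fin n → ℝ}
    (hx : ∀ i, x i ∈ Icc (0 : ℝ) 1) (j : Fin m) : percentileMechanism p x j ∈ Icc (0 : ℝ) 1 := by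
  unfold percentileMechanism
  split_ifs
  · exact hx _
  · simp

/-! ### The distribution function -/

section Distribution

variable {μ : Measure ℝ} {f : ℝ → ℝ}

theorem HasContinuousDensity.measure_Ioc (hμ : HasContinuousDensity μ f) {s t : ℝ} (hs : 0 ≤ s)
    (ht : t ≤ 1) : μ (Ioc s t) = ∫⁻ u in Ioc s t, ENNReal.ofReal (f u) := by
  rw [hμ.eq_withDensity, withDensity_apply _ measurableSet_Ioc, Measure.restrict_restrict
    measurableSet_Ioc, inter_eq_left.2]
  exact fun u hu => ⟨hs.trans hu.1.le, hu.2.trans ht⟩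

theorem measureReal_Iic_sub [IsFiniteMeasure μ] {s t : ℝ} (hst : s ≤ t) :
    μ.real (Iic t) - μ.real (Iic s) = μ.real (Ioc s t) := by
  rw [← Iic_sdiff_Iic, measureReal_sdiff (Iic_subset_Iic.2 hst) measurableSet_Iic]

theorem HasContinuousDensity.measureReal_Iic_sub_le (hμ : HasContinuousDensity μ f) {s t C : ℝ}
    (hs : 0 ≤ s) (hst : s ≤ t) (ht : t ≤ 1) (hC : ∀ u ∈ Ioc s t, f u ≤ C) (hC0 : 0 ≤ C) :
    μ.real (Iic t) - μ.real (Iic s) ≤ C * (t - s) := by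
  have := hμ.isProbabilityMeasure
  rw [measureReal_Iic_sub hst]
  refine ENNReal.toReal_le_of_le_ofReal (mul_nonneg hC0 (by linarith)) ?_
  rw [hμ.measure_Ioc hs ht]
  calc ∫⁻ u in Ioc s t, ENNReal.ofReal (f u) ≤ ∫⁻ _u in Ioc s t, ENNReal.ofReal C :=
        setLIntegral_mono' measurableSet_Ioc fun u hu => ENNReal.ofReal_le_ofReal (hC u hu)
    _ = ENNReal.ofReal (C * (t - s)) := by
        rw [setLIntegral_const, Real.volume_Ioc, ENNReal.ofReal_mul hC0]

theorem HasContinuousDensity.le_measureReal_Iic_sub (hμ : HasContinuousDensity μ f) {s t C : ℝ}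
    (hs : 0 ≤ s) (hst : s ≤ t) (ht : t ≤ 1) (hC : ∀ u ∈ Ioc s t, C ≤ f u) (hC0 : 0 ≤ C) :
    C * (t - s) ≤ μ.real (Iic t) - μ.real (Iic s) := by
  have := hμ.isProbabilityMeasure
  rw [measureReal_Iic_sub hst, Measure.real, ← ENNReal.ofReal_le_iff_le_toReal (measure_ne_top _ _),
    hμ.measure_Ioc hs ht]
  calc ENNReal.ofReal (C * (t - s)) = ∫⁻ _u in Ioc s t, ENNReal.ofReal C := by
        rw [setLIntegral_const, Real.volume_Ioc, ENNReal.ofReal_mul hC0]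
    _ ≤ ∫⁻ u in Ioc s t, ENNReal.ofReal (f u) :=
        setLIntegral_mono' measurableSet_Ioc fun u hu => ENNReal.ofReal_le_ofReal (hC u hu)

theorem HasContinuousDensity.measure_eq_zero_of_disjoint (hμ : HasContinuousDensity μ f)
    {s : Set ℝ} (hs : MeasurableSet s) (h : Disjoint s (Ioc 0 1)) : μ s = 0 := by
  rw [hμ.eq_withDensity]
  refine withDensity_absolutelyContinuous _ _ ?_
  rw [Measure.restrict_apply hs]
  refine measure_mono_null (t := {0}) ?_ (by simp)
  rintro u ⟨hu, hu0, hu1⟩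
  by_contra hne
  exact disjoint_left.1 h hu ⟨lt_of_le_of_ne hu0 (Ne.symm hne), hu1⟩

theorem HasContinuousDensity.measureReal_Iic_of_nonpos (hμ : HasContinuousDensity μ f) {t : ℝ}
    (ht : t ≤ 0) : μ.real (Iic t) = 0 := by
  rw [Measure.real, hμ.measure_eq_zero_of_disjoint measurableSet_Iic, ENNReal.toReal_zero]
  exact disjoint_left.2 fun u hu hu' => absurd hu'.1 (not_lt.2 (le_trans hu ht))

theorem HasContinuousDensity.measureReal_Iic_of_one_le (hμ : HasContinuousDensity μ f) {t : ℝ}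
    (ht : 1 ≤ t) : μ.real (Iic t) = 1 := by
  have := hμ.isProbabilityMeasure
  have h : μ (Iic t)ᶜ = 0 := by
    rw [compl_Iic]
    refine hμ.measure_eq_zero_of_disjoint measurableSet_Ioi ?_
    exact disjoint_left.2 fun u hu hu' => absurd hu'.2 (not_le.2 (lt_of_le_of_lt ht hu))
  rw [Measure.real, (prob_compl_eq_zero_iff measurableSet_Iic).1 h, ENNReal.toReal_one]

theorem measureReal_Iic_mono [IsFiniteMeasure μ] : Monotone fun t => μ.real (Iic t) :=
  fun _ _ hst => measureReal_mono (Iic_subset_Iic.2 hst)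

/-- The distribution function is Lipschitz. -/
theorem HasContinuousDensity.exists_lipschitz (hμ : HasContinuousDensity μ f) :
    ∃ M > 0, ∀ s t, s ≤ t → μ.real (Iic t) - μ.real (Iic s) ≤ M * (t - s) := by
  have := hμ.isProbabilityMeasure
  obtain ⟨C, hC⟩ := isCompact_Icc.exists_bound_of_continuousOn hμ.continuousOn
  refine ⟨max C 1, by positivity, fun s t hst => ?_⟩
  have hpos : (0 : ℝ) ≤ max C 1 := by positivity
  -- The distribution function is constant outside `[0,1]`, so both arguments can be clamped to the
  -- interval where the density is bounded.
  have hproj : ∀ t : ℝ, μ.real (Iic t) = μ.real (Iic (max 0 (min 1 t))) := by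
    intro t
    rcases le_total t 0 with h | h
    · rw [hμ.measureReal_Iic_of_nonpos h, hμ.measureReal_Iic_of_nonpos (by simp [h])]
    · rcases le_total 1 t with h' | h'
      · rw [hμ.measureReal_Iic_of_one_le h', hμ.measureReal_Iic_of_one_le (by simp [h'])]
      · rw [min_eq_right h', max_eq_right h]
  have hle : max 0 (min 1 s) ≤ max 0 (min 1 t) := by gcongr
  have h1 := hμ.measureReal_Iic_sub_le (C := max C 1) (le_max_left 0 (min 1 s)) hle (by simp)
    (fun u hu => ?_) hpos
  · rw [hproj s, hproj t]
    refine h1.trans (mul_le_mul_of_nonneg_left ?_ hpos)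
    rcases max_cases 0 (min 1 s) with h | h <;> rcases max_cases 0 (min 1 t) with h' | h' <;>
      rcases min_cases 1 s with h'' | h'' <;> rcases min_cases 1 t with h3 | h3 <;> linarith
  · have hu0 : u ∈ Icc (0 : ℝ) 1 :=
      ⟨(le_max_left 0 _).trans hu.1.le, hu.2.trans (by simp)⟩
    exact (le_abs_self _).trans ((hC u hu0).trans (le_max_left _ _))

theorem HasContinuousDensity.continuous_measureReal_Iic (hμ : HasContinuousDensity μ f) :
    Continuous fun t => μ.real (Iic t) := by
  have := hμ.isProbabilityMeasure
  obtain ⟨M, hM, hL⟩ := hμ.exists_lipschitz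
  refine (LipschitzWith.of_le_add_mul ⟨M, hM.le⟩ fun s t => ?_).continuous
  rw [Real.dist_eq]
  change _ ≤ _ + M * _
  rcases le_total s t with h | h
  · have := measureReal_Iic_mono (μ := μ) h
    simp only at this
    have : 0 ≤ M * |s - t| := by positivity
    linarith
  · rw [abs_of_nonneg (by linarith)]
    linarith [hL t s h]

end Distribution

/-! ### Typical samples -/

/-- A sample in `[0,1]` whose empirical distribution gives each interval the mass of `μ`, up to an
error of at most `δ`. -/
def IsTypicalSample (μ : Measure ℝ) (δ : ℝ) {n : ℕ} (x : Fin n → ℝ) : Prop :=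
  (∀ i, x i ∈ Icc (0 : ℝ) 1) ∧ ∀ s t, s ≤ t →
    |((Finset.univ.filter fun i => x i ∈ Icc s t).card : ℝ) - n * (μ.real (Iic t) - μ.real (Iic s))|
      ≤ δ * n

section Typical

variable {μ : Measure ℝ} {f : ℝ → ℝ}

/-- Chebyshev's inequality: the count is a sum of `n` independent indicators, so its variance is at
most `n`. -/
theorem measure_count_deviation_le [IsProbabilityMeasure μ] {B : Set ℝ} (hB : MeasurableSet B)
    {n : ℕ} (hn : 0 < n) {δ : ℝ} (hδ : 0 < δ) :
    (Measure.pi fun _ : Fin n => μ)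
      {x | δ * n ≤ |∑ i, B.indicator (fun _ => (1 : ℝ)) (x i) - n * μ.real B|}
      ≤ ENNReal.ofReal (1 / (δ ^ 2 * n)) := by
  have hn' : (0 : ℝ) < n := by exact_mod_cast hn
  set g : ℝ → ℝ := B.indicator fun _ => 1 with hg
  have hgm : Measurable g := measurable_const.indicator hB
  have hg0 : ∀ u, 0 ≤ g u ∧ g u ≤ 1 := by
    intro u
    by_cases hu : u ∈ B <;> simp [hg, hu]
  have hLp : MemLp g 2 μ := by
    refine MemLp.of_bound hgm.aestronglyMeasurable 1 (ae_of_all _ fun u => ?_)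
    rw [Real.norm_eq_abs, abs_le]
    constructor <;> linarith [(hg0 u).1, (hg0 u).2]
  let X : (Fin n → ℝ) → ℝ := ∑ i : Fin n, fun x => g (x i)
  have hLpi : ∀ i : Fin n, MemLp (fun x : Fin n → ℝ => g (x i)) 2 (Measure.pi fun _ => μ) :=
    fun i => hLp.comp_measurePreserving (measurePreserving_eval (fun _ : Fin n => μ) i)
  have hX : MemLp X 2 (Measure.pi fun _ => μ) := memLp_finsetSum' _ fun i _ => hLpi i
  have hvar : ProbabilityTheory.variance X (Measure.pi fun _ => μ) ≤ n := by
    have h1 := ProbabilityTheory.variance_sum_pi (μ := fun _ : Fin n => μ) (X := fun _ => g)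
      fun _ => hLp
    change ProbabilityTheory.variance X _ = _ at h1
    rw [h1]
    have h2 : ProbabilityTheory.variance g μ ≤ 1 := by
      have := ProbabilityTheory.variance_le_sq_of_bounded (μ := μ) (X := g) (a := 0) (b := 1)
        (ae_of_all _ fun u => hg0 u) hgm.aemeasurable
      norm_num at this
      linarith
    calc ∑ _i : Fin n, ProbabilityTheory.variance g μ ≤ ∑ _i : Fin n, (1 : ℝ) :=
          Finset.sum_le_sum fun _ _ => h2
      _ = n := by simp
  have hmean : ∫ x, X x ∂(Measure.pi fun _ => μ) = n * μ.real B := by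
    have h1 : ∀ i : Fin n, ∫ x : Fin n → ℝ, g (x i) ∂(Measure.pi fun _ => μ) = μ.real B := by
      intro i
      rw [integral_comp_eval (μ := fun _ : Fin n => μ) (i := i) hgm.aestronglyMeasurable, hg,
        integral_indicator_const _ hB, smul_eq_mul, mul_one]
    calc ∫ x, X x ∂(Measure.pi fun _ => μ)
        = ∫ x, ∑ i : Fin n, g (x i) ∂(Measure.pi fun _ => μ) := by simp [X, Finset.sum_apply]
      _ = ∑ i : Fin n, ∫ x : Fin n → ℝ, g (x i) ∂(Measure.pi fun _ => μ) :=
          integral_finsetSum _ fun i _ => (hLpi i).integrable (by norm_num)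
      _ = n * μ.real B := by simp [h1]
  have hcheb := ProbabilityTheory.meas_ge_le_variance_div_sq hX (c := δ * n) (by positivity)
  rw [hmean] at hcheb
  have hXapp : ∀ x, X x = ∑ i, g (x i) := fun x => by simp [X, Finset.sum_apply]
  simp_rw [hXapp] at hcheb
  refine hcheb.trans (ENNReal.ofReal_le_ofReal ?_)
  calc ProbabilityTheory.variance X (Measure.pi fun _ => μ) / (δ * n) ^ 2 ≤ n / (δ * n) ^ 2 := by
        gcongr
    _ = 1 / (δ ^ 2 * n) := by field_simp

theorem sum_indicator_eq_card {n : ℕ} (x : Fin n → ℝ) (B : Set ℝ) [DecidablePred (· ∈ B)] :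
    ∑ i, B.indicator (fun _ => (1 : ℝ)) (x i) = (Finset.univ.filter fun i => x i ∈ B).card := by
  rw [Finset.card_filter]
  push_cast
  exact Finset.sum_congr rfl fun i _ => by simp [indicator_apply]

/-- If the empirical distribution function is close to the distribution function on a fine grid, the
sample is typical. -/
theorem isTypicalSample_of_grid (hμ : HasContinuousDensity μ f) {M : ℝ} (hM : 0 < M)
    (hL : ∀ s t, s ≤ t → μ.real (Iic t) - μ.real (Iic s) ≤ M * (t - s)) {δ : ℝ} {N : ℕ}
    (hN : 0 < N) (hMN : 2 * M / N ≤ δ) {n : ℕ} {x : Fin n → ℝ} (hx : ∀ i, x i ∈ Icc (0 : ℝ) 1)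
    (hgrid : ∀ k ∈ Finset.range (N + 3),
      |((Finset.univ.filter fun i => x i ∈ Iic (((k : ℝ) - 1) / N)).card : ℝ)
        - n * μ.real (Iic (((k : ℝ) - 1) / N))| ≤ δ * n) :
    IsTypicalSample μ (4 * δ) x := by
  have := hμ.isProbabilityMeasure
  have hN' : (0 : ℝ) < N := by exact_mod_cast hN
  have hδ : 0 < δ := lt_of_lt_of_le (by positivity) hMN
  have hn0 : (0 : ℝ) ≤ n := Nat.cast_nonneg n
  have key : ∀ t, |((Finset.univ.filter fun i => x i ≤ t).card : ℝ) - n * μ.real (Iic t)|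
        ≤ 2 * δ * n ∧
      |((Finset.univ.filter fun i => x i < t).card : ℝ) - n * μ.real (Iic t)| ≤ 2 * δ * n := by
    intro t
    rcases lt_or_ge t 0 with ht0 | ht0
    · have h1 : (Finset.univ.filter fun i => x i ≤ t) = ∅ :=
        Finset.filter_eq_empty_iff.2 fun i _ => not_le.2 (ht0.trans_le (hx i).1)
      have h2 : (Finset.univ.filter fun i => x i < t) = ∅ :=
        Finset.filter_eq_empty_iff.2 fun i _ => not_lt.2 (ht0.le.trans (hx i).1)
      rw [h1, h2, hμ.measureReal_Iic_of_nonpos ht0.le]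
      simp only [Finset.card_empty, Nat.cast_zero, mul_zero, sub_zero, abs_zero]
      exact ⟨by positivity, by positivity⟩
    rcases lt_or_ge 1 t with ht1 | ht1
    · have h1 : (Finset.univ.filter fun i => x i ≤ t) = Finset.univ :=
        Finset.filter_true_of_mem fun i _ => (hx i).2.trans ht1.le
      have h2 : (Finset.univ.filter fun i => x i < t) = Finset.univ :=
        Finset.filter_true_of_mem fun i _ => (hx i).2.trans_lt ht1
      rw [h1, h2, hμ.measureReal_Iic_of_one_le ht1.le]
      simp only [Finset.card_univ, Fintype.card_fin, mul_one, sub_self, abs_zero]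
      exact ⟨by positivity, by positivity⟩
    -- The grid runs from `-1/N` to `(N+1)/N`, so each `t` in `[0,1]` lies strictly between the grid
    -- points `(k-1)/N` and `(k+1)/N`. Strictness lets the same bracket control both `x i ≤ t` and
    -- `x i < t`. The grid error and the oscillation `2 * M / N` contribute `δ` each.
    set k := ⌊t * N⌋₊ with hk
    have hk1 : (k : ℝ) ≤ t * N := Nat.floor_le (by positivity)
    have hk2 : t * N < k + 1 := Nat.lt_floor_add_one _
    have hkN : k ≤ N := by
      have : (k : ℝ) ≤ N := hk1.trans (by nlinarith)
      exact_mod_cast this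
    have hlo := hgrid k (Finset.mem_range.2 (by omega))
    have hhi := hgrid (k + 2) (Finset.mem_range.2 (by omega))
    have e2 : (((k + 2 : ℕ) : ℝ) - 1) / N = (k + 1) / N := by push_cast; ring
    rw [e2] at hhi
    have hlt : ((k : ℝ) - 1) / N < t := by
      rw [div_lt_iff₀ hN']
      linarith
    have htl : t < ((k : ℝ) + 1) / N := by
      rw [lt_div_iff₀ hN']
      exact hk2
    have hF := hL _ _ (hlt.trans htl).le
    have e3 : M * (((k : ℝ) + 1) / N - (k - 1) / N) = 2 * M / N := by field_simp; ring
    rw [e3] at hF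
    have m1 := measureReal_Iic_mono (μ := μ) hlt.le
    have m2 := measureReal_Iic_mono (μ := μ) htl.le
    simp only at m1 m2
    have c1 : ((Finset.univ.filter fun i => x i ∈ Iic (((k : ℝ) - 1) / N)).card : ℝ)
        ≤ (Finset.univ.filter fun i => x i < t).card := by
      refine Nat.cast_le.2 (Finset.card_le_card fun i hi => ?_)
      simp only [Finset.mem_filter, Finset.mem_univ, true_and, mem_Iic] at hi ⊢
      exact hi.trans_lt hlt
    have c2 : ((Finset.univ.filter fun i => x i < t).card : ℝ)
        ≤ (Finset.univ.filter fun i => x i ≤ t).card := by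
      refine Nat.cast_le.2 (Finset.card_le_card fun i hi => ?_)
      simp only [Finset.mem_filter, Finset.mem_univ, true_and] at hi ⊢
      exact hi.le
    have c3 : ((Finset.univ.filter fun i => x i ≤ t).card : ℝ)
        ≤ (Finset.univ.filter fun i => x i ∈ Iic (((k : ℝ) + 1) / N)).card := by
      refine Nat.cast_le.2 (Finset.card_le_card fun i hi => ?_)
      simp only [Finset.mem_filter, Finset.mem_univ, true_and, mem_Iic] at hi ⊢
      exact hi.trans htl.le
    rw [abs_le] at hlo hhi
    have n1 : n * μ.real (Iic t) ≤ n * μ.real (Iic (((k : ℝ) - 1) / N)) + δ * n := by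
      nlinarith
    have n2 : n * μ.real (Iic (((k : ℝ) + 1) / N)) ≤ n * μ.real (Iic t) + δ * n := by
      nlinarith
    constructor <;> rw [abs_le] <;> constructor <;> linarith [hlo.1, hhi.2]
  refine ⟨hx, fun s t hst => ?_⟩
  -- A closed interval is a difference of two counts, each with error `2 * δ * n`; hence the factor
  -- `4`.
  have hcard : ((Finset.univ.filter fun i => x i ∈ Icc s t).card : ℝ)
      = (Finset.univ.filter fun i => x i ≤ t).card - (Finset.univ.filter fun i => x i < s).card := by
    have hsub : (Finset.univ.filter fun i => x i < s) ⊆ Finset.univ.filter fun i => x i ≤ t := by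
      intro i hi
      simp only [Finset.mem_filter, Finset.mem_univ, true_and] at hi ⊢
      exact hi.le.trans hst
    rw [eq_sub_iff_add_eq, ← Nat.cast_add, ← Finset.card_sdiff_add_card_eq_card hsub]
    congr 3
    ext i
    simp only [Finset.mem_filter, Finset.mem_univ, true_and, mem_Icc, Finset.mem_sdiff, not_lt]
    tauto
  rw [hcard]
  have h1 := abs_le.1 (key t).1
  have h2 := abs_le.1 (key s).2
  rw [abs_le]
  constructor <;> linarith [h1.1, h1.2, h2.1, h2.2]

/-- A large sample is typical with probability at least `1/2`. -/
theorem eventually_exists_typical_event (hμ : HasContinuousDensity μ f) {δ : ℝ} (hδ : 0 < δ) :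
    ∀ᶠ n : ℕ in atTop, ∃ G : Set (Fin n → ℝ), MeasurableSet G ∧
      ENNReal.ofReal (1 / 2) ≤ (Measure.pi fun _ : Fin n => μ) G ∧
      ∀ x ∈ G, IsTypicalSample μ δ x := by
  have := hμ.isProbabilityMeasure
  obtain ⟨M, hM, hL⟩ := hμ.exists_lipschitz
  set ε := δ / 4 with hε
  have hε0 : 0 < ε := by positivity
  obtain ⟨N, hN⟩ := exists_nat_gt (2 * M / ε)
  have hN' : (0 : ℝ) < N := lt_trans (by positivity) hN
  have hN0 : 0 < N := by exact_mod_cast hN'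
  have hMN : 2 * M / N ≤ ε := by
    rw [div_lt_iff₀ hε0] at hN
    rw [div_le_iff₀ hN']
    linarith
  -- Each of the `N + 3` grid events fails with probability at most `1 / (ε ^ 2 * n)`; this size of
  -- `n` makes the union bound at most `1/2`.
  obtain ⟨n₀, hn₀⟩ := exists_nat_gt (2 * (N + 3) / ε ^ 2)
  filter_upwards [eventually_ge_atTop (n₀ + 1)] with n hn
  have hn0 : 0 < n := by omega
  have hn' : (0 : ℝ) < n := by exact_mod_cast hn0
  have hnn : (2 * (N + 3) / ε ^ 2 : ℝ) < n := hn₀.trans_le (by exact_mod_cast (by omega : n₀ ≤ n))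
  let I : Set (Fin n → ℝ) := Set.pi univ fun _ => Icc (0 : ℝ) 1
  let D : ℕ → Set (Fin n → ℝ) := fun k =>
    {x | ε * n ≤ |∑ i, (Iic (((k : ℝ) - 1) / N)).indicator (fun _ => (1 : ℝ)) (x i)
      - n * μ.real (Iic (((k : ℝ) - 1) / N))|}
  let U : Set (Fin n → ℝ) := ⋃ k ∈ Finset.range (N + 3), D k
  have hIm : MeasurableSet I := MeasurableSet.univ_pi fun _ => measurableSet_Icc
  have hDm : ∀ k, MeasurableSet (D k) := by
    intro k
    refine measurableSet_le measurable_const ?_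
    have : ∀ i : Fin n, Measurable fun x : Fin n → ℝ =>
        (Iic (((k : ℝ) - 1) / N)).indicator (fun _ => (1 : ℝ)) (x i) := fun i =>
      (measurable_const.indicator measurableSet_Iic).comp (measurable_pi_apply i)
    fun_prop
  have hUm : MeasurableSet U := Finset.measurableSet_biUnion _ fun k _ => hDm k
  have hI1 : (Measure.pi fun _ : Fin n => μ) I = 1 := by
    have h : μ (Icc (0 : ℝ) 1) = 1 := by
      rw [← prob_compl_eq_zero_iff measurableSet_Icc]
      refine hμ.measure_eq_zero_of_disjoint measurableSet_Icc.compl ?_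
      exact disjoint_left.2 fun u hu hu' => hu ⟨hu'.1.le, hu'.2⟩
    rw [Measure.pi_pi]
    simp [h]
  have hU : (Measure.pi fun _ : Fin n => μ) U ≤ ENNReal.ofReal (1 / 2) := by
    calc (Measure.pi fun _ : Fin n => μ) U
        ≤ ∑ k ∈ Finset.range (N + 3), (Measure.pi fun _ : Fin n => μ) (D k) :=
          measure_biUnion_finset_le _ _
      _ ≤ ∑ _k ∈ Finset.range (N + 3), ENNReal.ofReal (1 / (ε ^ 2 * n)) :=
          Finset.sum_le_sum fun k _ => measure_count_deviation_le measurableSet_Iic hn0 hε0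
      _ = ENNReal.ofReal ((N + 3) * (1 / (ε ^ 2 * n))) := by
          rw [Finset.sum_const, Finset.card_range, nsmul_eq_mul,
            ENNReal.ofReal_mul (by positivity)]
          congr 1
          rw [← ENNReal.ofReal_natCast]
          push_cast
          rfl
      _ ≤ ENNReal.ofReal (1 / 2) := by
          refine ENNReal.ofReal_le_ofReal ?_
          rw [div_lt_iff₀ (by positivity)] at hnn
          rw [mul_one_div, div_le_div_iff₀ (by positivity) (by positivity)]
          linarith
  refine ⟨I \ U, hIm.diff hUm, ?_, ?_⟩
  · refine le_trans ?_ (le_measure_sdiff (μ := Measure.pi fun _ : Fin n => μ) (s₁ := I) (s₂ := U))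
    rw [hI1]
    refine ENNReal.le_sub_of_add_le_right (measure_ne_top _ _) ?_
    calc ENNReal.ofReal (1 / 2) + (Measure.pi fun _ : Fin n => μ) U
        ≤ ENNReal.ofReal (1 / 2) + ENNReal.ofReal (1 / 2) := by gcongr
      _ = 1 := by
        rw [← ENNReal.ofReal_add (by norm_num) (by norm_num)]
        norm_num
  · rintro x ⟨hxI, hxU⟩
    have h4 : δ = 4 * ε := by rw [hε]; ring
    rw [h4]
    refine isTypicalSample_of_grid hμ hM hL hN0 hMN (fun i => hxI i (mem_univ i)) fun k hk => ?_
    have hxk : x ∉ D k := fun h => hxU (mem_biUnion (by simpa using hk) h)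
    simp only [D, mem_ofPred_eq, not_le] at hxk
    rw [sum_indicator_eq_card] at hxk
    exact hxk.le

/-- A mechanism that loses a fixed fraction of the number of agents on typical samples is not
asymptotically optimal. -/
theorem not_isAsymptoticallyOptimal_of_gain {m : ℕ} (hμ : HasContinuousDensity μ f)
    {q : Fin m → ℝ} {tie : ∀ n : ℕ, Fin m → Equiv.Perm (Fin n)} {p : Fin m → ℝ} {κ δ : ℝ}
    (hκ : 0 < κ) (hδ : 0 < δ)
    (h : ∀ᶠ n : ℕ in atTop, ∀ x : Fin n → ℝ, IsTypicalSample μ δ x →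
      nashWelfare q (tie n) x (percentileMechanism p x) + ENNReal.ofReal (κ * n)
        ≤ optWelfare q (tie n) x) :
    ¬ IsAsymptoticallyOptimal μ q tie p := by
  intro hopt
  have := hμ.isProbabilityMeasure
  have hlt : (1 : ℝ≥0∞) < ENNReal.ofReal (1 + κ / 2) := by
    rw [← ENNReal.ofReal_one]
    exact (ENNReal.ofReal_lt_ofReal_iff (by positivity)).2 (by linarith)
  have hev := hopt.eventually (eventually_lt_nhds hlt)
  obtain ⟨n, hn, hgain, ⟨G, hGm, hG, hGt⟩, hn1⟩ := (hev.and (h.and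
    ((eventually_exists_typical_event hμ hδ).and (eventually_ge_atTop 1)))).exists
  refine absurd hn (not_lt.2 ?_)
  have hn' : (0 : ℝ) < n := by exact_mod_cast hn1
  unfold bayesianRatio
  set P := Measure.pi fun _ : Fin n => μ
  set E := ∫⁻ x : Fin n → ℝ, nashWelfare q (tie n) x (percentileMechanism p x) ∂P with hE
  have hEn : E ≤ n := by
    calc E ≤ ∫⁻ _x : Fin n → ℝ, (n : ℝ≥0∞) ∂P := lintegral_mono fun x => nashWelfare_le_card
      _ = n := by simp [P]
  have hx01 : ∀ᵐ x ∂P, ∀ i, x i ∈ Icc (0 : ℝ) 1 := by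
    rw [ae_all_iff]
    intro i
    have h1 : ∀ᵐ u ∂μ, u ∈ Icc (0 : ℝ) 1 :=
      hμ.measure_eq_zero_of_disjoint measurableSet_Icc.compl
        (disjoint_left.2 fun u hu hu' => hu ⟨hu'.1.le, hu'.2⟩)
    exact (measurePreserving_eval (fun _ : Fin n => μ) i).quasiMeasurePreserving.ae h1
  have hO : E + ENNReal.ofReal (κ / 2 * n) ≤ ∫⁻ x : Fin n → ℝ, optWelfare q (tie n) x ∂P := by
    calc E + ENNReal.ofReal (κ / 2 * n)
        ≤ E + ∫⁻ x, G.indicator (fun _ => ENNReal.ofReal (κ * n)) x ∂P := by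
          gcongr
          rw [lintegral_indicator_const hGm]
          calc ENNReal.ofReal (κ / 2 * n) = ENNReal.ofReal (κ * n) * ENNReal.ofReal (1 / 2) := by
                rw [← ENNReal.ofReal_mul (by positivity)]
                congr 1
                ring
            _ ≤ _ := by gcongr
      _ = ∫⁻ x, (nashWelfare q (tie n) x (percentileMechanism p x)
            + G.indicator (fun _ => ENNReal.ofReal (κ * n)) x) ∂P := by
          -- Additivity needs measurability of one summand only. The indicator provides it, so
          -- measurability of the welfare is never required.
          rw [lintegral_add_right _ (measurable_const.indicator hGm)]
      _ ≤ ∫⁻ x : Fin n → ℝ, optWelfare q (tie n) x ∂P := by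
          refine lintegral_mono_ae (hx01.mono fun x hx => ?_)
          by_cases hxG : x ∈ G
          · rw [indicator_of_mem hxG]
            exact hgain x (hGt x hxG)
          · rw [indicator_of_notMem hxG, add_zero]
            exact nashWelfare_le_optWelfare fun j => percentileMechanism_mem_Icc hx j
  have hpos : 0 < ENNReal.ofReal (κ / 2 * n) := ENNReal.ofReal_pos.2 (by positivity)
  rw [ENNReal.le_div_iff_mul_le (Or.inr (ne_of_gt (hpos.trans_le (le_add_self.trans hO))))
    (Or.inl (ne_of_lt (hEn.trans_lt (ENNReal.natCast_lt_top n))))]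
  -- As `E ≤ n`, the gain `κ / 2 * n` is at least `κ / 2 * E`.
  refine le_trans ?_ hO
  rw [ENNReal.ofReal_add zero_le_one (by positivity), ENNReal.ofReal_one, add_mul, one_mul,
    ENNReal.ofReal_mul (by positivity), ENNReal.ofReal_natCast]
  gcongr

end Typical

/-! ### Two facilities -/

theorem eq_or_eq_of_ne_fin_two {a b : Fin 2} (hab : a ≠ b) (j : Fin 2) : j = a ∨ j = b := by
  omega

theorem sum_fin_two_of_ne {M : Type*} [AddCommMonoid M] {a b : Fin 2} (hab : a ≠ b)
    (g : Fin 2 → M) : ∑ j, g j = g a + g b := by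
  have : (Finset.univ : Finset (Fin 2)) = {a, b} := by
    ext j
    simpa using eq_or_eq_of_ne_fin_two hab j
  rw [this, Finset.sum_pair hab]

/-- The stability of an assignment to two facilities. -/
theorem isStableAssignment_fin_two {n : ℕ} {q : Fin 2 → ℝ} {tie : Fin 2 → Equiv.Perm (Fin n)}
    {x : Fin n → ℝ} {y : Fin 2 → ℝ} {a b : Fin 2} (hab : a ≠ b) {Sa Sb : Finset (Fin n)}
    (hdisj : Disjoint Sa Sb) (ha : Sa.card = ⌊q a * (n : ℝ)⌋₊) (hb : Sb.card = ⌊q b * (n : ℝ)⌋₊)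
    (hSa : ∀ i ∉ Sa, (∀ k ∈ Sa, Precedes tie x y a k i) ∨ (i ∈ Sb ∧ |x i - y b| ≤ |x i - y a|))
    (hSb : ∀ i ∉ Sb, (∀ k ∈ Sb, Precedes tie x y b k i) ∨ (i ∈ Sa ∧ |x i - y a| ≤ |x i - y b|)) :
    ∃ A, IsStableAssignment q tie x y A ∧ A a = Sa ∧ A b = Sb := by
  obtain ⟨A, hAa, hAb⟩ : ∃ A : Fin 2 → Finset (Fin n), A a = Sa ∧ A b = Sb :=
    ⟨fun j => if j = a then Sa else Sb, if_pos rfl, if_neg hab.symm⟩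
  refine ⟨A, ⟨?_, ?_, ?_⟩, hAa, hAb⟩
  · intro j k hjk
    rcases eq_or_eq_of_ne_fin_two hab j with rfl | rfl <;>
      rcases eq_or_eq_of_ne_fin_two hab k with rfl | rfl
    · exact absurd rfl hjk
    · rw [hAa, hAb]; exact hdisj
    · rw [hAa, hAb]; exact hdisj.symm
    · exact absurd rfl hjk
  · intro j
    rcases eq_or_eq_of_ne_fin_two hab j with rfl | rfl
    · rw [hAa]; exact ha.le
    · rw [hAb]; exact hb.le
  · intro j i hi
    rcases eq_or_eq_of_ne_fin_two hab j with rfl | rfl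
    · rw [hAa] at hi ⊢
      rcases hSa i hi with h | h
      · exact Or.inl ⟨ha, h⟩
      · exact Or.inr ⟨b, by rw [hAb]; exact h.1, h.2⟩
    · rw [hAb] at hi ⊢
      rcases hSb i hi with h | h
      · exact Or.inl ⟨hb, h⟩
      · exact Or.inr ⟨a, by rw [hAa]; exact h.1, h.2⟩

/-! ### Instability of facilities that compete for agents -/

/-- The stable assignment when the agents of `Ba` and `Bb` are the closest to the facilities `a` and
`b`, the agents of `L` are behind facility `a`, and those of `R` behind facility `b`. -/
theorem exists_stable_of_layers {n : ℕ} {q : Fin 2 → ℝ} {tie : Fin 2 → Equiv.Perm (Fin n)}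
    {x : Fin n → ℝ} {y : Fin 2 → ℝ} {a b : Fin 2} (hab : a ≠ b) {L R Ba Bb : Finset (Fin n)}
    (hcover : ∀ i, i ∈ L ∨ i ∈ R ∨ i ∈ Ba ∨ i ∈ Bb) (hB : Disjoint Ba Bb)
    (hL : ∀ i ∈ L, |x i - y a| = 1 / 5 ∧ |x i - y b| = 2 / 5)
    (hR : ∀ i ∈ R, |x i - y a| = 1 / 2 ∧ |x i - y b| = 3 / 10)
    (hBa : ∀ i ∈ Ba, |x i - y a| ≤ 1 / 10 ∧ |x i - y a| ≤ |x i - y b|)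
    (hBb : ∀ i ∈ Bb, |x i - y b| ≤ 1 / 10 ∧ |x i - y b| ≤ |x i - y a|) {ea eb : ℕ}
    (hea : Ba.card + ea = ⌊q a * (n : ℝ)⌋₊) (heb : Bb.card + eb = ⌊q b * (n : ℝ)⌋₊)
    (hcard : ea + eb ≤ L.card + R.card) :
    ∃ A, IsStableAssignment q tie x y A ∧ ∑ j, ∑ i ∈ A j, (1 - |x i - y j|)
      = ∑ i ∈ Ba, (1 - |x i - y a|) + ∑ i ∈ Bb, (1 - |x i - y b|)
        + (min L.card ea : ℕ) * (4 / 5 : ℝ) + (ea - min L.card ea : ℕ) * (1 / 2 : ℝ)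
        + (min R.card eb : ℕ) * (7 / 10 : ℝ) + (eb - min R.card eb : ℕ) * (3 / 5 : ℝ) := by
  -- Agents of `L` are nearer to `a` than to `b`, and also nearer to `a` than the agents of `R` are;
  -- symmetrically for `R` and `b`. So spare places go first to the facility's own layer and only
  -- the remainder to the opposite one.
  obtain ⟨La, hLa, hLac, hLaf⟩ := exists_first_subset tie x y a L (min_le_left L.card ea)
  obtain ⟨Rb, hRb, hRbc, hRbf⟩ := exists_first_subset tie x y b R (min_le_left R.card eb)
  have hc1 : ea - min L.card ea ≤ (R \ Rb).card := by
    rw [Finset.card_sdiff_of_subset hRb]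
    omega
  have hc2 : eb - min R.card eb ≤ (L \ La).card := by
    rw [Finset.card_sdiff_of_subset hLa]
    omega
  obtain ⟨Ra, hRa, hRac, hRaf⟩ := exists_first_subset tie x y a (R \ Rb) hc1
  obtain ⟨Lb, hLb, hLbc, hLbf⟩ := exists_first_subset tie x y b (L \ La) hc2
  have hRaR : ∀ i ∈ Ra, i ∈ R ∧ i ∉ Rb := fun i hi => Finset.mem_sdiff.1 (hRa hi)
  have hLbL : ∀ i ∈ Lb, i ∈ L ∧ i ∉ La := fun i hi => Finset.mem_sdiff.1 (hLb hi)
  have hLR : ∀ i ∈ L, i ∉ R := fun i hi hi' => by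
    have := (hL i hi).1; have := (hR i hi').1; linarith
  have hLBa : ∀ i ∈ L, i ∉ Ba := fun i hi hi' => by
    have := (hL i hi).1; have := (hBa i hi').1; linarith
  have hLBb : ∀ i ∈ L, i ∉ Bb := fun i hi hi' => by
    have := (hL i hi).2; have := (hBb i hi').1; linarith
  have hRBa : ∀ i ∈ R, i ∉ Ba := fun i hi hi' => by
    have := (hR i hi).1; have := (hBa i hi').1; linarith
  have hRBb : ∀ i ∈ R, i ∉ Bb := fun i hi hi' => by
    have := (hR i hi).2; have := (hBb i hi').1; linarith
  have hd1 : Disjoint Ba (La ∪ Ra) := Finset.disjoint_left.2 fun i hi hi' => by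
    rcases Finset.mem_union.1 hi' with h | h
    · exact hLBa i (hLa h) hi
    · exact hRBa i (hRaR i h).1 hi
  have hd2 : Disjoint La Ra := Finset.disjoint_left.2 fun i hi hi' =>
    hLR i (hLa hi) (hRaR i hi').1
  have hd3 : Disjoint Bb (Rb ∪ Lb) := Finset.disjoint_left.2 fun i hi hi' => by
    rcases Finset.mem_union.1 hi' with h | h
    · exact hRBb i (hRb h) hi
    · exact hLBb i (hLbL i h).1 hi
  have hd4 : Disjoint Rb Lb := Finset.disjoint_left.2 fun i hi hi' =>
    hLR i (hLbL i hi').1 (hRb hi)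
  have hca : (Ba ∪ (La ∪ Ra)).card = ⌊q a * (n : ℝ)⌋₊ := by
    rw [Finset.card_union_of_disjoint hd1, Finset.card_union_of_disjoint hd2]
    omega
  have hcb : (Bb ∪ (Rb ∪ Lb)).card = ⌊q b * (n : ℝ)⌋₊ := by
    rw [Finset.card_union_of_disjoint hd3, Finset.card_union_of_disjoint hd4]
    omega
  -- A facility that does not serve its whole own layer has no place for the opposite layer.
  have hempty : ∀ {B S T : Finset (Fin n)} {e : ℕ}, S ⊆ B → S.card = min B.card e →
      T.card = e - min B.card e → ∀ i ∈ B, i ∉ S → T = ∅ := by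
    intro B S T e hSB hS hT i hi hiS
    have h1 : S.card < B.card := Finset.card_lt_card
      ((Finset.ssubset_iff_of_subset hSB).2 ⟨i, hi, hiS⟩)
    rw [← Finset.card_eq_zero]
    omega
  have hdisj : Disjoint (Ba ∪ (La ∪ Ra)) (Bb ∪ (Rb ∪ Lb)) := by
    rw [Finset.disjoint_left]
    intro i hi hi'
    simp only [Finset.mem_union] at hi hi'
    rcases hi with h | h | h <;> rcases hi' with h' | h' | h'
    · exact Finset.disjoint_left.1 hB h h'
    · exact hRBa i (hRb h') h
    · exact hLBa i (hLbL i h').1 h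
    · exact hLBb i (hLa h) h'
    · exact hLR i (hLa h) (hRb h')
    · exact (hLbL i h').2 h
    · exact hRBb i (hRaR i h).1 h'
    · exact (hRaR i h).2 h'
    · exact hLR i (hLbL i h').1 (hRaR i h).1
  have hSa : ∀ i ∉ Ba ∪ (La ∪ Ra), (∀ k ∈ Ba ∪ (La ∪ Ra), Precedes tie x y a k i) ∨
      (i ∈ Bb ∪ (Rb ∪ Lb) ∧ |x i - y b| ≤ |x i - y a|) := by
    intro i hi
    simp only [Finset.mem_union, not_or] at hi
    by_cases hiL : i ∈ L
    · left
      intro k hk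
      rw [hempty hLa hLac hRac i hiL hi.2.1, Finset.union_empty] at hk
      rcases Finset.mem_union.1 hk with h | h
      · exact precedes_of_dist_lt (by rw [(hL i hiL).1]; linarith [(hBa k h).1])
      · exact hLaf k h i hiL hi.2.1
    · by_cases hib : i ∈ Bb ∪ (Rb ∪ Lb)
      · right
        refine ⟨hib, ?_⟩
        simp only [Finset.mem_union] at hib
        rcases hib with h | h | h
        · exact (hBb i h).2
        · rw [(hR i (hRb h)).1, (hR i (hRb h)).2]; norm_num
        · exact absurd (hLbL i h).1 hiL
      · left
        simp only [Finset.mem_union, not_or] at hib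
        have hiR : i ∈ R := by
          rcases hcover i with h | h | h | h
          · exact absurd h hiL
          · exact h
          · exact absurd h hi.1
          · exact absurd h hib.1
        intro k hk
        simp only [Finset.mem_union] at hk
        rcases hk with h | h | h
        · exact precedes_of_dist_lt (by rw [(hR i hiR).1]; linarith [(hBa k h).1])
        · exact precedes_of_dist_lt (by rw [(hR i hiR).1, (hL k (hLa h)).1]; norm_num)
        · exact hRaf k h i (Finset.mem_sdiff.2 ⟨hiR, hib.2.1⟩) hi.2.2
  have hSb : ∀ i ∉ Bb ∪ (Rb ∪ Lb), (∀ k ∈ Bb ∪ (Rb ∪ Lb), Precedes tie x y b k i) ∨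
      (i ∈ Ba ∪ (La ∪ Ra) ∧ |x i - y a| ≤ |x i - y b|) := by
    intro i hi
    simp only [Finset.mem_union, not_or] at hi
    by_cases hiR : i ∈ R
    · left
      intro k hk
      rw [hempty hRb hRbc hLbc i hiR hi.2.1, Finset.union_empty] at hk
      rcases Finset.mem_union.1 hk with h | h
      · exact precedes_of_dist_lt (by rw [(hR i hiR).2]; linarith [(hBb k h).1])
      · exact hRbf k h i hiR hi.2.1
    · by_cases hib : i ∈ Ba ∪ (La ∪ Ra)
      · right
        refine ⟨hib, ?_⟩
        simp only [Finset.mem_union] at hib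
        rcases hib with h | h | h
        · exact (hBa i h).2
        · rw [(hL i (hLa h)).1, (hL i (hLa h)).2]; norm_num
        · exact absurd (hRaR i h).1 hiR
      · left
        simp only [Finset.mem_union, not_or] at hib
        have hiL : i ∈ L := by
          rcases hcover i with h | h | h | h
          · exact h
          · exact absurd h hiR
          · exact absurd h hib.1
          · exact absurd h hi.1
        intro k hk
        simp only [Finset.mem_union] at hk
        rcases hk with h | h | h
        · exact precedes_of_dist_lt (by rw [(hL i hiL).2]; linarith [(hBb k h).1])
        · exact precedes_of_dist_lt (by rw [(hL i hiL).2, (hR k (hRb h)).2]; norm_num)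
        · exact hLbf k h i (Finset.mem_sdiff.2 ⟨hiL, hib.2.1⟩) hi.2.2
  obtain ⟨A, hA, hAa, hAb⟩ := isStableAssignment_fin_two (q := q) (tie := tie) (x := x) (y := y) hab
    (Sa := Ba ∪ (La ∪ Ra)) (Sb := Bb ∪ (Rb ∪ Lb)) hdisj hca hcb hSa hSb
  refine ⟨A, hA, ?_⟩
  rw [sum_fin_two_of_ne hab, hAa, hAb, Finset.sum_union hd1, Finset.sum_union hd2,
    Finset.sum_union hd3, Finset.sum_union hd4]
  have s1 : ∑ i ∈ La, (1 - |x i - y a|) = La.card * (4 / 5 : ℝ) := by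
    rw [Finset.sum_congr rfl fun i hi => by rw [(hL i (hLa hi)).1], Finset.sum_const,
      nsmul_eq_mul]
    norm_num
  have s2 : ∑ i ∈ Ra, (1 - |x i - y a|) = Ra.card * (1 / 2 : ℝ) := by
    rw [Finset.sum_congr rfl fun i hi => by rw [(hR i (hRaR i hi).1).1], Finset.sum_const,
      nsmul_eq_mul]
    norm_num
  have s3 : ∑ i ∈ Rb, (1 - |x i - y b|) = Rb.card * (7 / 10 : ℝ) := by
    rw [Finset.sum_congr rfl fun i hi => by rw [(hR i (hRb hi)).2], Finset.sum_const,
      nsmul_eq_mul]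
    norm_num
  have s4 : ∑ i ∈ Lb, (1 - |x i - y b|) = Lb.card * (3 / 5 : ℝ) := by
    rw [Finset.sum_congr rfl fun i hi => by rw [(hL i (hLbL i hi).1).2], Finset.sum_const,
      nsmul_eq_mul]
    norm_num
  rw [s1, s2, s3, s4, hLac, hRac, hRbc, hLbc]
  ring

/-- An agent halfway between the two facilities may select either of them; the two equilibria have
different Social Welfare. -/
theorem exists_nash_of_indifferent_agent {n : ℕ} {q : Fin 2 → ℝ}
    {tie : Fin 2 → Equiv.Perm (Fin n)} {x : Fin n → ℝ} {y : Fin 2 → ℝ} {a b : Fin 2} (hab : a ≠ b)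
    (ha : y a = 2 / 5) (hb : y b = 3 / 5) {L R Ca Cb : Finset (Fin n)} {z : Fin n}
    (hcover : ∀ i, i ∈ L ∨ i ∈ R ∨ i ∈ Ca ∨ i ∈ Cb ∨ i = z)
    (hL : ∀ i ∈ L, x i = 1 / 5) (hR : ∀ i ∈ R, x i = 9 / 10) (hCa : ∀ i ∈ Ca, x i = 2 / 5)
    (hCb : ∀ i ∈ Cb, x i = 3 / 5) (hz : x z = 1 / 2)
    (hca : Ca.card < ⌊q a * (n : ℝ)⌋₊) (hcb : Cb.card < ⌊q b * (n : ℝ)⌋₊)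
    (hcap : ⌊q a * (n : ℝ)⌋₊ + ⌊q b * (n : ℝ)⌋₊ ≤ n) :
    ∃ s s', IsNash q tie x y s ∧ IsNash q tie x y s' ∧
      socialWelfare q tie x y s ≠ socialWelfare q tie x y s' := by
  have hzCa : z ∉ Ca := fun h => by have := hCa z h; linarith
  have hzCb : z ∉ Cb := fun h => by have := hCb z h; linarith
  have hCab : Disjoint Ca Cb := Finset.disjoint_left.2 fun i hi hi' => by
    have := hCa i hi; have := hCb i hi'; linarith
  have hn : n ≤ L.card + R.card + Ca.card + Cb.card + 1 := by
    have h1 : (Finset.univ : Finset (Fin n)) ⊆ L ∪ R ∪ Ca ∪ Cb ∪ {z} := fun i _ => by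
      simp only [Finset.mem_union, Finset.mem_singleton]
      have := hcover i
      tauto
    have h2 := Finset.card_le_card h1
    rw [Finset.card_univ, Fintype.card_fin] at h2
    have h3 := Finset.card_union_le (L ∪ R ∪ Ca ∪ Cb) {z}
    have h4 := Finset.card_union_le (L ∪ R ∪ Ca) Cb
    have h5 := Finset.card_union_le (L ∪ R) Ca
    have h6 := Finset.card_union_le L R
    rw [Finset.card_singleton] at h3
    omega
  have hdL : ∀ i ∈ L, |x i - y a| = 1 / 5 ∧ |x i - y b| = 2 / 5 := fun i hi => by
    rw [hL i hi, ha, hb]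
    norm_num [abs_of_neg]
  have hdR : ∀ i ∈ R, |x i - y a| = 1 / 2 ∧ |x i - y b| = 3 / 10 := fun i hi => by
    rw [hR i hi, ha, hb]
    norm_num [abs_of_pos]
  have hdCa : ∀ i ∈ Ca, |x i - y a| ≤ 1 / 10 ∧ |x i - y a| ≤ |x i - y b| := fun i hi => by
    rw [hCa i hi, ha, hb]
    norm_num
  have hdCb : ∀ i ∈ Cb, |x i - y b| ≤ 1 / 10 ∧ |x i - y b| ≤ |x i - y a| := fun i hi => by
    rw [hCb i hi, ha, hb]
    norm_num
  have hza : |x z - y a| = 1 / 10 := by rw [hz, ha]; norm_num [abs_of_pos]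
  have hzb : |x z - y b| = 1 / 10 := by rw [hz, hb]; norm_num [abs_of_neg]
  obtain ⟨ea, hea⟩ : ∃ e, Ca.card + 1 + e = ⌊q a * (n : ℝ)⌋₊ := ⟨_, Nat.add_sub_of_le hca⟩
  obtain ⟨eb, heb⟩ : ∃ e, Cb.card + 1 + e = ⌊q b * (n : ℝ)⌋₊ := ⟨_, Nat.add_sub_of_le hcb⟩
  -- In the first assignment `z` is served by `a`, which leaves `b` one more spare place; in the
  -- second the roles are exchanged.
  obtain ⟨A, hA, hAw⟩ := exists_stable_of_layers (q := q) (tie := tie) hab (L := L) (R := R)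
    (Ba := insert z Ca) (Bb := Cb) (ea := ea) (eb := eb + 1)
    (fun i => by rw [Finset.mem_insert]; have := hcover i; tauto)
    (Finset.disjoint_insert_left.2 ⟨hzCb, hCab⟩) hdL hdR
    (fun i hi => by
      rcases Finset.mem_insert.1 hi with rfl | h
      · rw [hza, hzb]; norm_num
      · exact hdCa i h) hdCb
    (by rw [Finset.card_insert_of_notMem hzCa]; omega) (by omega) (by omega)
  obtain ⟨A', hA', hAw'⟩ := exists_stable_of_layers (q := q) (tie := tie) hab (L := L) (R := R)
    (Ba := Ca) (Bb := insert z Cb) (ea := ea + 1) (eb := eb)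
    (fun i => by rw [Finset.mem_insert]; have := hcover i; tauto)
    (Finset.disjoint_insert_right.2 ⟨hzCa, hCab⟩) hdL hdR hdCa
    (fun i hi => by
      rcases Finset.mem_insert.1 hi with rfl | h
      · rw [hza, hzb]; norm_num
      · exact hdCb i h)
    (by omega) (by rw [Finset.card_insert_of_notMem hzCb]; omega) (by omega)
  have h1 : ∀ i j, |x i - y j| ≤ 1 := by
    intro i j
    refine abs_sub_le_one_of_mem_Icc ?_ ?_
    · rcases hcover i with h | h | h | h | h
      · rw [hL i h]; norm_num
      · rw [hR i h]; norm_num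
      · rw [hCa i h]; norm_num
      · rw [hCb i h]; norm_num
      · rw [h, hz]; norm_num
    · rcases eq_or_eq_of_ne_fin_two hab j with rfl | rfl
      · rw [ha]; norm_num
      · rw [hb]; norm_num
  obtain ⟨s, hs, hsw⟩ := hA.exists_isNash h1
  obtain ⟨s', hs', hsw'⟩ := hA'.exists_isNash h1
  refine ⟨s, s', hs, hs', ?_⟩
  rw [hsw, hsw', hAw, hAw', Finset.sum_insert hzCa, Finset.sum_insert hzCb, hza, hzb]
  intro h
  -- The extra place is worth `4/5` or `1/2` at `a` and `7/10` or `3/5` at `b`, according to which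
  -- layer fills it. No value at `a` equals one at `b`. Both layers cannot be exhausted, since there
  -- are enough agents to fill all places.
  rcases le_or_gt L.card ea with hl | hl <;> rcases le_or_gt R.card eb with hr | hr
  · omega
  · rw [min_eq_left hl, min_eq_right (by omega : eb + 1 ≤ R.card),
      min_eq_left (by omega : L.card ≤ ea + 1), min_eq_right (by omega : eb ≤ R.card),
      Nat.cast_sub hl, Nat.cast_sub (by omega : L.card ≤ ea + 1)] at h
    push_cast [Nat.sub_self] at h
    linarith
  · rw [min_eq_left hr, min_eq_right (by omega : ea + 1 ≤ L.card),
      min_eq_left (by omega : R.card ≤ eb + 1), min_eq_right (by omega : ea ≤ L.card),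
      Nat.cast_sub hr, Nat.cast_sub (by omega : R.card ≤ eb + 1)] at h
    push_cast [Nat.sub_self] at h
    linarith
  · rw [min_eq_right (by omega : ea + 1 ≤ L.card), min_eq_right (by omega : eb + 1 ≤ R.card),
      min_eq_right (by omega : ea ≤ L.card), min_eq_right (by omega : eb ≤ R.card)] at h
    push_cast [Nat.sub_self] at h
    linarith

theorem card_filter_val_mem_Ico_le {n : ℕ} (k l : ℕ) :
    (Finset.univ.filter fun i : Fin n => k ≤ i.val ∧ i.val < l).card ≤ l - k := by
  rw [← Nat.card_Ico, ← Finset.card_map Fin.valEmbedding]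
  refine Finset.card_le_card fun i hi => ?_
  simp only [Finset.mem_map, Finset.mem_filter, Finset.mem_univ, true_and,
    Fin.valEmbedding_apply] at hi
  obtain ⟨i, hi, rfl⟩ := hi
  exact Finset.mem_Ico.2 hi

theorem percentileMechanism_of_monotone {n m : ℕ} {p : Fin m → ℝ} {x : Fin n → ℝ}
    (hx : Monotone x) {j : Fin m} (h : ⌊p j * ((n : ℝ) - 1)⌋₊ < n) :
    percentileMechanism p x j = x ⟨⌊p j * ((n : ℝ) - 1)⌋₊, h⟩ := by
  unfold percentileMechanism
  rw [dif_pos h, Tuple.sort_eq_refl_iff_monotone.2 hx]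
  rfl

/-- If fewer agents lie between the facilities than these can accommodate, the percentile mechanism
is not equilibrium-stable. -/
theorem not_isEquilibriumStable_of_lt {q : Fin 2 → ℝ} (hq : ∀ j, 0 < q j) (hq' : ∑ j, q j < 1)
    {tie : ∀ n : ℕ, Fin 2 → Equiv.Perm (Fin n)} {p : Fin 2 → ℝ}
    (hp : ∀ j, p j ∈ Icc (0 : ℝ) 1) {a b : Fin 2} (hab : p a < p b)
    (hlt : p b - p a < ∑ j, q j) : ¬ IsEquilibriumStable q tie p := by
  have hne : a ≠ b := by
    rintro rfl
    exact lt_irrefl _ hab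
  rw [sum_fin_two_of_ne hne] at hq' hlt
  -- The bounds on `n` give capacities of at least `2`, facility indices that differ by at least
  -- `2`, and room in the total capacity for the agents from index `A` to index `B` with one place
  -- to spare.
  obtain ⟨n, hn⟩ := exists_nat_gt (max (max (2 / q a) (2 / q b))
    (max (3 / (p b - p a) + 1) (5 / (q a + q b - (p b - p a)))))
  simp only [max_lt_iff] at hn
  obtain ⟨⟨hn1, hn2⟩, hn3, hn4⟩ := hn
  rw [div_lt_iff₀ (hq a)] at hn1
  rw [div_lt_iff₀ (hq b)] at hn2
  rw [← lt_sub_iff_add_lt, div_lt_iff₀ (by linarith)] at hn3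
  rw [div_lt_iff₀ (by linarith)] at hn4
  have hn0 : (0 : ℝ) < n := by
    by_contra h
    have : (n : ℝ) = 0 := le_antisymm (not_lt.1 h) (Nat.cast_nonneg n)
    rw [this] at hn1
    linarith
  have hnpos : 0 < n := by exact_mod_cast hn0
  have hnge1 : (1 : ℝ) ≤ n := by exact_mod_cast hnpos
  have hia := percentile_index_lt hnpos (hp a)
  have hib := percentile_index_lt hnpos (hp b)
  have fa1 : (⌊p a * ((n : ℝ) - 1)⌋₊ : ℝ) ≤ p a * ((n : ℝ) - 1) :=
    Nat.floor_le (mul_nonneg (hp a).1 (by linarith))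
  have fa2 := Nat.lt_floor_add_one (p a * ((n : ℝ) - 1))
  have fb1 : (⌊p b * ((n : ℝ) - 1)⌋₊ : ℝ) ≤ p b * ((n : ℝ) - 1) :=
    Nat.floor_le (mul_nonneg (hp b).1 (by linarith))
  have fb2 := Nat.lt_floor_add_one (p b * ((n : ℝ) - 1))
  have ka1 : (⌊q a * (n : ℝ)⌋₊ : ℝ) ≤ q a * n := Nat.floor_le (by have := hq a; positivity)
  have ka2 := Nat.lt_floor_add_one (q a * (n : ℝ))
  have kb1 : (⌊q b * (n : ℝ)⌋₊ : ℝ) ≤ q b * n := Nat.floor_le (by have := hq b; positivity)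
  have kb2 := Nat.lt_floor_add_one (q b * (n : ℝ))
  have hka : 2 ≤ ⌊q a * (n : ℝ)⌋₊ := Nat.le_floor (by push_cast; linarith)
  have hkb : 2 ≤ ⌊q b * (n : ℝ)⌋₊ := Nat.le_floor (by push_cast; linarith)
  have hcap : ⌊q a * (n : ℝ)⌋₊ + ⌊q b * (n : ℝ)⌋₊ ≤ n := by
    have : ((⌊q a * (n : ℝ)⌋₊ + ⌊q b * (n : ℝ)⌋₊ : ℕ) : ℝ) ≤ n := by
      push_cast
      nlinarith
    exact_mod_cast this
  have hlow : ⌊p a * ((n : ℝ) - 1)⌋₊ + 2 ≤ ⌊p b * ((n : ℝ) - 1)⌋₊ := by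
    have : ((⌊p a * ((n : ℝ) - 1)⌋₊ + 2 : ℕ) : ℝ) < (⌊p b * ((n : ℝ) - 1)⌋₊ + 1 : ℕ) := by
      push_cast
      nlinarith
    exact Nat.le_of_lt_succ (by exact_mod_cast this)
  have hupp : ⌊p b * ((n : ℝ) - 1)⌋₊ + 2
      ≤ ⌊p a * ((n : ℝ) - 1)⌋₊ + ⌊q a * (n : ℝ)⌋₊ + ⌊q b * (n : ℝ)⌋₊ := by
    have : ((⌊p b * ((n : ℝ) - 1)⌋₊ + 2 : ℕ) : ℝ)
        ≤ (⌊p a * ((n : ℝ) - 1)⌋₊ + ⌊q a * (n : ℝ)⌋₊ + ⌊q b * (n : ℝ)⌋₊ : ℕ) := by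
      push_cast
      nlinarith
    exact_mod_cast this
  generalize hA : ⌊p a * ((n : ℝ) - 1)⌋₊ = A at *
  generalize hB : ⌊p b * ((n : ℝ) - 1)⌋₊ = B at *
  -- Agent `c` will be the indifferent one; the `c - A` agents at `a` and the `B - c` agents at `b`
  -- each leave their facility a place for it.
  obtain ⟨c, hc1, hc2, hc3, hc4⟩ : ∃ c, A < c ∧ c < B ∧ c - A < ⌊q a * (n : ℝ)⌋₊ ∧
      B - c < ⌊q b * (n : ℝ)⌋₊ :=
    ⟨min (B - 1) (A + (⌊q a * (n : ℝ)⌋₊ - 1)), by omega, by omega, by omega, by omega⟩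
  let x : Fin n → ℝ := fun i => if i.val < A then 1 / 5 else if i.val < c then 2 / 5 else
    if i.val < c + 1 then 1 / 2 else if i.val < B + 1 then 3 / 5 else 9 / 10
  have hx : Monotone x := by
    intro i k hik
    have hik' : i.val ≤ k.val := hik
    simp only [x]
    split_ifs <;> first | omega | norm_num
  have hxI : ∀ i, x i ∈ Icc (0 : ℝ) 1 := by
    intro i
    simp only [x]
    split_ifs <;> norm_num
  have hya : percentileMechanism p x a = 2 / 5 := by
    rw [percentileMechanism_of_monotone hx (by rw [hA]; exact hia)]
    simp [x, hA, hc1]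
  have hyb : percentileMechanism p x b = 3 / 5 := by
    rw [percentileMechanism_of_monotone hx (by rw [hB]; exact hib)]
    simp only [x, hB]
    rw [if_neg (by omega), if_neg (by omega), if_neg (by omega), if_pos (by omega)]
  intro hstable
  obtain ⟨s, s', hs, hs', hne'⟩ := exists_nash_of_indifferent_agent (q := q) (tie := tie n) (x := x)
    hne hya hyb
    (L := Finset.univ.filter fun i => i.val < A) (R := Finset.univ.filter fun i => B + 1 ≤ i.val)
    (Ca := Finset.univ.filter fun i => A ≤ i.val ∧ i.val < c)
    (Cb := Finset.univ.filter fun i => c + 1 ≤ i.val ∧ i.val < B + 1) (z := ⟨c, by omega⟩)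
    (fun i => by
      simp only [Finset.mem_filter, Finset.mem_univ, true_and, Fin.ext_iff]
      omega)
    (fun i hi => by
      simp only [Finset.mem_filter, Finset.mem_univ, true_and] at hi
      simp only [x, if_pos hi])
    (fun i hi => by
      simp only [Finset.mem_filter, Finset.mem_univ, true_and] at hi
      simp only [x]
      rw [if_neg (by omega), if_neg (by omega), if_neg (by omega), if_neg (by omega)])
    (fun i hi => by
      simp only [Finset.mem_filter, Finset.mem_univ, true_and] at hi
      simp only [x]
      rw [if_neg (by omega), if_pos (by omega)])
    (fun i hi => by
      simp only [Finset.mem_filter, Finset.mem_univ, true_and] at hi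
      simp only [x]
      rw [if_neg (by omega), if_neg (by omega), if_neg (by omega), if_pos (by omega)])
    (by
      simp only [x]
      rw [if_neg (by omega), if_neg (by omega), if_pos (by omega)])
    (lt_of_le_of_lt (card_filter_val_mem_Ico_le _ _) hc3)
    (lt_of_le_of_lt (card_filter_val_mem_Ico_le _ _) (by omega)) hcap
  exact hne' (hstable n x hxI s s' hs hs')

/-! ### Two facilities at the same place -/

/-- Agents sit at `u`, and `T` is served best by two facilities at `0`. If the second facility is
moved to `ε`, any stable assignment `A₁, A₂` is better, provided that at least half of `T` is on the
side of `ε` and that short intervals contain few agents. -/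
theorem le_welfare_of_split {ι : Type*} [Fintype ι] [DecidableEq ι] {u : ι → ℝ} {ε τ : ℝ}
    (hε : 0 < ε) {A₁ A₂ T : Finset ι} (hdisj : Disjoint A₁ A₂)
    (hTcard : T.card = A₁.card + A₂.card)
    (h₁ : ∀ i ∉ A₁, (∀ a ∈ A₁, |u a| ≤ |u i|) ∨ (i ∈ A₂ ∧ |u i - ε| ≤ |u i|))
    (h₂ : ∀ i ∉ A₂, (∀ a ∈ A₂, |u a - ε| ≤ |u i - ε|) ∨ (i ∈ A₁ ∧ |u i| ≤ |u i - ε|))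
    (hT : ∀ t ∈ T, ∀ i ∉ T, |u t| ≤ |u i|)
    (hwin : ∀ s, ((Finset.univ.filter fun i => u i ∈ Icc s (s + 2 * ε)).card : ℝ) ≤ τ)
    (hside : (T.filter fun i => u i < 0).card ≤ (T.filter fun i => 0 < u i).card) :
    ∑ i ∈ T, (1 - |u i|) + ε * ((min A₁.card A₂.card : ℕ) - 10 * τ)
      ≤ ∑ i ∈ A₁, (1 - |u i|) + ∑ i ∈ A₂, (1 - |u i - ε|) := by
  have hτ : 0 ≤ τ := (Nat.cast_nonneg _).trans (hwin 0)
  set A := A₁ ∪ A₂ with hA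
  have hAcard : A.card = A₁.card + A₂.card := Finset.card_union_of_disjoint hdisj
  have hTA : (A \ T).card = (T \ A).card := by
    have e1 := Finset.card_sdiff_add_card_inter A T
    have e2 := Finset.card_sdiff_add_card_inter T A
    rw [Finset.inter_comm] at e2
    omega
  -- the agents that are served only after the move, or only before it
  have hexch : ∑ i ∈ T, (1 - |u i|) ≤ ∑ i ∈ A, (1 - |u i|) + 2 * ε * (2 * τ) ∧
      ((A \ T).card : ℝ) ≤ 2 * τ := by
    rcases (T \ A).eq_empty_or_nonempty with h | h
    · have hAT : A \ T = ∅ := by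
        rw [← Finset.card_eq_zero, hTA, h, Finset.card_empty]
      have : A = T := (Finset.sdiff_eq_empty_iff_subset.1 hAT).antisymm
        (Finset.sdiff_eq_empty_iff_subset.1 h)
      rw [hAT, this]
      simp only [Finset.card_empty, Nat.cast_zero]
      exact ⟨by linarith [mul_nonneg (mul_nonneg zero_le_two hε.le) (mul_nonneg zero_le_two hτ)],
        by positivity⟩
    -- Both facilities refuse `t`, so no served agent is more than `2 * ε` farther from `0` than
    -- `t`. Agents of `A \ T` are also no nearer than `t`, so they lie in two windows of length `2 *
    -- ε`.
    · obtain ⟨t, ht, hmin⟩ := Finset.exists_min_image (T \ A) (fun i => |u i|) h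
      rw [Finset.mem_sdiff, hA, Finset.mem_union, not_or] at ht
      have hA1 : ∀ a ∈ A₁, |u a| ≤ |u t| := by
        rcases h₁ t ht.2.1 with h | h
        · exact h
        · exact absurd h.1 ht.2.2
      have hA2 : ∀ a ∈ A₂, |u a - ε| ≤ |u t - ε| := by
        rcases h₂ t ht.2.2 with h | h
        · exact h
        · exact absurd h.1 ht.2.1
      have hupp : ∀ a ∈ A, |u a| ≤ |u t| + 2 * ε := by
        intro a ha
        rcases Finset.mem_union.1 ha with h | h
        · linarith [hA1 a h]
        · have e1 := hA2 a h
          have e2 := abs_sub_abs_le_abs_sub (u a) ε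
          have e3 := abs_sub (u t) ε
          rw [abs_of_pos hε] at e2 e3
          linarith
      have hlow : ∀ a ∈ A \ T, |u t| ≤ |u a| := fun a ha => hT t ht.1 a (Finset.mem_sdiff.1 ha).2
      have hcard : ((A \ T).card : ℝ) ≤ 2 * τ := by
        have hsub : A \ T ⊆ (Finset.univ.filter fun i => u i ∈ Icc |u t| (|u t| + 2 * ε)) ∪
            (Finset.univ.filter fun i =>
              u i ∈ Icc (-|u t| - 2 * ε) (-|u t| - 2 * ε + 2 * ε)) := by
          intro a ha
          have e1 := hlow a ha
          have e2 := hupp a (Finset.mem_sdiff.1 ha).1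
          simp only [Finset.mem_union, Finset.mem_filter, Finset.mem_univ, true_and, mem_Icc]
          rcases le_total 0 (u a) with h | h
          · rw [abs_of_nonneg h] at e1 e2
            exact Or.inl ⟨e1, e2⟩
          · rw [abs_of_nonpos h] at e1 e2
            exact Or.inr ⟨by linarith, by linarith⟩
        have h3 := (Finset.card_le_card hsub).trans (Finset.card_union_le _ _)
        have h4 : ((A \ T).card : ℝ) ≤ _ := Nat.cast_le.2 h3
        rw [Nat.cast_add] at h4
        linarith [hwin |u t|, hwin (-|u t| - 2 * ε)]
      refine ⟨?_, hcard⟩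
      rw [← Finset.sum_inter_add_sum_sdiff T A, ← Finset.sum_inter_add_sum_sdiff A T,
        Finset.inter_comm A T]
      have s1 : ∑ i ∈ T \ A, (1 - |u i|) ≤ (T \ A).card • (1 - |u t|) :=
        Finset.sum_le_card_nsmul _ _ _ fun i hi => by linarith [hmin i hi]
      have s2 : (A \ T).card • (1 - |u t| - 2 * ε) ≤ ∑ i ∈ A \ T, (1 - |u i|) :=
        Finset.card_nsmul_le_sum _ _ _ fun i hi => by
          linarith [hupp i (Finset.mem_sdiff.1 hi).1]
      rw [nsmul_eq_mul] at s1 s2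
      rw [← hTA] at s1
      nlinarith
  obtain ⟨hsum, hATcard⟩ := hexch
  have hAsum : ∑ i ∈ A, (1 - |u i|) = ∑ i ∈ A₁, (1 - |u i|) + ∑ i ∈ A₂, (1 - |u i|) :=
    Finset.sum_union hdisj
  -- the effect of the move on the agents of the second facility
  have hmove : ∑ i ∈ A₂, (1 - |u i|) + ε * (A₂.card - 2 * (A₂.filter fun i => u i < ε).card)
      ≤ ∑ i ∈ A₂, (1 - |u i - ε|) := by
    have e1 : ε * (A₂.card - 2 * (A₂.filter fun i => u i < ε).card : ℝ)
        = ∑ i ∈ A₂, (ε - if u i < ε then 2 * ε else 0) := by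
      rw [Finset.sum_sub_distrib, ← Finset.sum_filter, Finset.sum_const, Finset.sum_const,
        nsmul_eq_mul, nsmul_eq_mul]
      ring
    rw [e1, ← Finset.sum_add_distrib]
    refine Finset.sum_le_sum fun i _ => ?_
    split_ifs with h
    · have := abs_sub (u i) ε
      rw [abs_of_pos hε] at this
      linarith
    · push Not at h
      rw [abs_of_nonneg (by linarith : 0 ≤ u i - ε), abs_of_nonneg (by linarith : 0 ≤ u i)]
      linarith
  have hzero : ∀ B : Finset ι, ((B.filter fun i => u i < ε).card : ℝ)
      ≤ (B.filter fun i => u i < 0).card + τ := by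
    intro B
    have hsub : B.filter (fun i => u i < ε) ⊆ B.filter (fun i => u i < 0) ∪
        Finset.univ.filter fun i => u i ∈ Icc 0 (0 + 2 * ε) := by
      intro i hi
      simp only [Finset.mem_union, Finset.mem_filter, Finset.mem_univ, true_and, mem_Icc] at hi ⊢
      rcases lt_or_ge (u i) 0 with h | h
      · exact Or.inl ⟨hi.1, h⟩
      · exact Or.inr ⟨h, by linarith [hi.2]⟩
    have h3 : ((B.filter fun i => u i < ε).card : ℝ) ≤ _ :=
      Nat.cast_le.2 ((Finset.card_le_card hsub).trans (Finset.card_union_le _ _))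
    rw [Nat.cast_add] at h3
    linarith [hwin 0]
  have hbal : ((min A₁.card A₂.card : ℕ) : ℝ) - 6 * τ
      ≤ A₂.card - 2 * (A₂.filter fun i => u i < ε).card := by
    have hm1 : ((min A₁.card A₂.card : ℕ) : ℝ) ≤ A₁.card := Nat.cast_le.2 (min_le_left _ _)
    have hm2 : ((min A₁.card A₂.card : ℕ) : ℝ) ≤ A₂.card := Nat.cast_le.2 (min_le_right _ _)
    -- If the second facility serves some `b` on the negative side, `b` must have been refused at
    -- `0`. Stability then forces all of `A₁` to lie left of `ε`. Since at most half of `T` is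
    -- negative, up to the window errors, `A₁` uses up most of that half and `A₂` is left with few
    -- agents there.
    rcases (A₂.filter fun i => u i < 0).eq_empty_or_nonempty with h | ⟨b, hb⟩
    · have := hzero A₂
      rw [h, Finset.card_empty, Nat.cast_zero] at this
      linarith
    · obtain ⟨hbA, hb0⟩ := Finset.mem_filter.1 hb
      have hbA1 : b ∉ A₁ := fun h => Finset.disjoint_left.1 hdisj h hbA
      have hblock : ∀ a ∈ A₁, |u a| ≤ -u b := by
        rcases h₁ b hbA1 with h | h
        · rwa [abs_of_neg hb0] at h
        · rw [abs_of_neg hb0, abs_of_neg (by linarith)] at h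
          linarith [h.2]
      have hA1 : ∀ a ∈ A₁, u a < ε := by
        intro a ha
        by_contra! hcon
        have e1 := hblock a ha
        rw [abs_of_nonneg (by linarith)] at e1
        rcases h₂ a (Finset.disjoint_left.1 hdisj ha) with h | h
        · have e2 := h b hbA
          rw [abs_of_neg (by linarith), abs_of_nonneg (by linarith)] at e2
          linarith
        · have e2 := h.2
          rw [abs_of_nonneg (by linarith), abs_of_nonneg (by linarith)] at e2
          linarith
      have c1 : (A.filter fun i => u i < ε).card
          = A₁.card + (A₂.filter fun i => u i < ε).card := by
        rw [hA, Finset.filter_union, Finset.card_union_of_disjoint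
          (Finset.disjoint_filter_filter hdisj), Finset.filter_true_of_mem hA1]
      have c2 : (A.filter fun i => u i < ε).card
          ≤ (T.filter fun i => u i < ε).card + (A \ T).card := by
        refine (Finset.card_le_card (fun i hi => ?_)).trans (Finset.card_union_le _ _)
        simp only [Finset.mem_union, Finset.mem_filter, Finset.mem_sdiff] at hi ⊢
        tauto
      have c3 : (T.filter fun i => u i < 0).card + (T.filter fun i => 0 < u i).card ≤ T.card := by
        rw [← Finset.card_union_of_disjoint]
        · exact Finset.card_le_card
            (Finset.union_subset (Finset.filter_subset _ _) (Finset.filter_subset _ _))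
        · exact Finset.disjoint_filter.2 fun i _ h h' => lt_asymm h h'
      have c4 := hzero T
      have r1 : ((A.filter fun i => u i < ε).card : ℝ)
          = A₁.card + (A₂.filter fun i => u i < ε).card := by exact_mod_cast c1
      have r2 : ((A.filter fun i => u i < ε).card : ℝ)
          ≤ (T.filter fun i => u i < ε).card + (A \ T).card := by exact_mod_cast c2
      have r3 : (2 * (T.filter fun i => u i < 0).card : ℝ) ≤ A₁.card + A₂.card := by
        have : 2 * (T.filter fun i => u i < 0).card ≤ A₁.card + A₂.card := by omega
        exact_mod_cast this
      linarith
  -- The imbalance costs `6 * τ` and the exchange of served agents `4 * τ`, which add up to `10 *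
  -- τ`.
  nlinarith

/-- The total capacity is less than the number of agents. -/
theorem floor_add_floor_lt {α β : ℝ} (hα : 0 < α) (hβ : 0 < β) (h : α + β < 1) {n : ℕ}
    (hn : 0 < n) : ⌊α * (n : ℝ)⌋₊ + ⌊β * (n : ℝ)⌋₊ < n := by
  have hn' : (0 : ℝ) < n := by exact_mod_cast hn
  have h1 : (⌊α * (n : ℝ)⌋₊ : ℝ) ≤ α * n := Nat.floor_le (by positivity)
  have h2 : (⌊β * (n : ℝ)⌋₊ : ℝ) ≤ β * n := Nat.floor_le (by positivity)
  have : ((⌊α * (n : ℝ)⌋₊ + ⌊β * (n : ℝ)⌋₊ : ℕ) : ℝ) < n := by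
    push_cast
    nlinarith
  exact_mod_cast this

/-- A stable assignment that leaves an agent unserved uses all the capacity. -/
theorem IsStableAssignment.card_eq {n m : ℕ} {q : Fin m → ℝ} {tie : Fin m → Equiv.Perm (Fin n)}
    {x : Fin n → ℝ} {y : Fin m → ℝ} {A : Fin m → Finset (Fin n)}
    (hA : IsStableAssignment q tie x y A) {i : Fin n} (hi : ∀ j, i ∉ A j) (j : Fin m) :
    (A j).card = ⌊q j * (n : ℝ)⌋₊ := by
  rcases hA.blocked_or j i (hi j) with h | ⟨k, hk, -⟩
  · exact h.1
  · exact absurd hk (hi k)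

/-- Two facilities at the same place are improved by moving one of them by `ε`, towards the side
on which most of the served agents are. -/
theorem nashWelfare_add_le_of_coincident {n : ℕ} {q : Fin 2 → ℝ}
    {tie : Fin 2 → Equiv.Perm (Fin n)} {x : Fin n → ℝ} (hx : ∀ i, x i ∈ Icc (0 : ℝ) 1)
    {y : Fin 2 → ℝ} {a b : Fin 2} (hab : a ≠ b) {c : ℝ} (ha : y a = c) (hb : y b = c)
    (hc : c ∈ Icc (0 : ℝ) 1) (hcap : ⌊q a * (n : ℝ)⌋₊ + ⌊q b * (n : ℝ)⌋₊ < n)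
    {ε τ : ℝ} (hε : 0 < ε)
    (hwin : ∀ s, ((Finset.univ.filter fun i => x i ∈ Icc s (s + 2 * ε)).card : ℝ) ≤ τ)
    (hτ : 10 * τ ≤ (min ⌊q a * (n : ℝ)⌋₊ ⌊q b * (n : ℝ)⌋₊ : ℕ))
    (hpos : 0 < (min ⌊q a * (n : ℝ)⌋₊ ⌊q b * (n : ℝ)⌋₊ : ℕ)) :
    nashWelfare q tie x y
      + ENNReal.ofReal (ε * ((min ⌊q a * (n : ℝ)⌋₊ ⌊q b * (n : ℝ)⌋₊ : ℕ) - 10 * τ))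
      ≤ optWelfare q tie x := by
  obtain ⟨T, -, hTcard, hT⟩ := exists_first_subset tie x (fun _ => c) a Finset.univ
    (c := ⌊q a * (n : ℝ)⌋₊ + ⌊q b * (n : ℝ)⌋₊) (by rw [Finset.card_univ, Fintype.card_fin]; omega)
  have hT' : ∀ t ∈ T, ∀ i ∉ T, |x t - c| ≤ |x i - c| := fun t ht i hi =>
    (hT t ht i (Finset.mem_univ i) hi).dist_le
  have hold : nashWelfare q tie x y ≤ ENNReal.ofReal (∑ i ∈ T, (1 - |x i - c|)) := by
    refine nashWelfare_le_ofReal fun A hA1 hA2 => ?_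
    rw [sum_fin_two_of_ne hab, ha, hb, ← Finset.sum_union (hA1 a b hab)]
    refine sum_le_sum_of_dominates (fun i _ => ?_) (fun t ht i _ hi => ?_) ?_
    · linarith [abs_sub_le_one_of_mem_Icc (hx i) hc]
    · linarith [hT' t ht i hi]
    · rw [hTcard]
      exact (Finset.card_union_le _ _).trans (add_le_add (hA2 a) (hA2 b))
  -- The sign `σ` orients the line so that the move goes to the positive side.
  obtain ⟨σ, hσ, hside⟩ : ∃ σ : ℝ, (σ = 1 ∨ σ = -1) ∧
      (T.filter fun i => σ * (x i - c) < 0).card ≤ (T.filter fun i => 0 < σ * (x i - c)).card := by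
    rcases le_total (T.filter fun i => x i - c < 0).card (T.filter fun i => 0 < x i - c).card
      with h | h
    · exact ⟨1, Or.inl rfl, by simpa using h⟩
    · refine ⟨-1, Or.inr rfl, ?_⟩
      simpa only [neg_mul, one_mul, neg_lt_zero, neg_pos] using h
  have hσσ : σ * σ = 1 := by rcases hσ with rfl | rfl <;> norm_num
  have hσabs : |σ| = 1 := by rcases hσ with rfl | rfl <;> norm_num
  have hwin' : ∀ s, ((Finset.univ.filter fun i => σ * (x i - c) ∈ Icc s (s + 2 * ε)).card : ℝ)
      ≤ τ := by
    intro s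
    rcases hσ with rfl | rfl
    · refine le_trans (Nat.cast_le.2 (Finset.card_le_card fun i hi => ?_)) (hwin (c + s))
      simp only [Finset.mem_filter, Finset.mem_univ, true_and, mem_Icc] at hi ⊢
      constructor <;> linarith [hi.1, hi.2]
    · refine le_trans (Nat.cast_le.2 (Finset.card_le_card fun i hi => ?_))
        (hwin (c - s - 2 * ε))
      simp only [Finset.mem_filter, Finset.mem_univ, true_and, mem_Icc] at hi ⊢
      constructor <;> linarith [hi.1, hi.2]
  -- If the new place were outside `[0,1]`, all agents on that side would be in one window, hence at
  -- most `τ` of them. They make up at least half of `T`, contradicting `hτ` and `hpos`.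
  have hnew : c + σ * ε ∈ Icc (0 : ℝ) 1 := by
    by_contra hout
    have hsmall : ∀ i, σ * (x i - c) < ε := by
      intro i
      by_contra! hcon
      refine hout ?_
      have hxi := hx i
      rcases hσ with rfl | rfl <;> constructor <;> linarith [hxi.1, hxi.2, hc.1, hc.2]
    have h1 : ((T.filter fun i => ¬ σ * (x i - c) < 0).card : ℝ) ≤ τ := by
      refine le_trans (Nat.cast_le.2 (Finset.card_le_card fun i hi => ?_)) (hwin' 0)
      simp only [Finset.mem_filter, Finset.mem_univ, true_and, mem_Icc, not_lt] at hi ⊢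
      exact ⟨hi.2, by linarith [hsmall i]⟩
    have h2 := Finset.card_filter_add_card_filter_not (s := T) (fun i => σ * (x i - c) < 0)
    have h3 : (T.filter fun i => 0 < σ * (x i - c)).card
        ≤ (T.filter fun i => ¬ σ * (x i - c) < 0).card :=
      Finset.card_le_card fun i hi => by
        simp only [Finset.mem_filter, not_lt] at hi ⊢
        exact ⟨hi.1, hi.2.le⟩
    have h4 : (min ⌊q a * (n : ℝ)⌋₊ ⌊q b * (n : ℝ)⌋₊)
        ≤ 2 * (T.filter fun i => ¬ σ * (x i - c) < 0).card := by omega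
    have h5 : ((min ⌊q a * (n : ℝ)⌋₊ ⌊q b * (n : ℝ)⌋₊ : ℕ) : ℝ)
        ≤ 2 * (T.filter fun i => ¬ σ * (x i - c) < 0).card := by exact_mod_cast h4
    have h6 : (0 : ℝ) < (min ⌊q a * (n : ℝ)⌋₊ ⌊q b * (n : ℝ)⌋₊ : ℕ) := by exact_mod_cast hpos
    linarith
  obtain ⟨y', hy'a, hy'b⟩ : ∃ y' : Fin 2 → ℝ, y' a = c ∧ y' b = c + σ * ε :=
    ⟨fun j => if j = a then c else c + σ * ε, if_pos rfl, if_neg hab.symm⟩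
  have hy' : ∀ j, y' j ∈ Icc (0 : ℝ) 1 := by
    intro j
    rcases eq_or_eq_of_ne_fin_two hab j with rfl | rfl
    · rwa [hy'a]
    · rwa [hy'b]
  obtain ⟨A, hA⟩ := exists_isStableAssignment q tie x y'
  -- An unserved agent exists because the total capacity is below `n`; it certifies that both
  -- facilities are full.
  obtain ⟨i₀, hi₀⟩ : ∃ i, ∀ j, i ∉ A j := by
    have h1 : (A a ∪ A b).card < (Finset.univ : Finset (Fin n)).card := by
      rw [Finset.card_univ, Fintype.card_fin]
      have := Finset.card_union_le (A a) (A b)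
      have := hA.card_le a
      have := hA.card_le b
      omega
    obtain ⟨i, -, hi⟩ := Finset.exists_mem_notMem_of_card_lt_card h1
    rw [Finset.mem_union, not_or] at hi
    refine ⟨i, fun j => ?_⟩
    rcases eq_or_eq_of_ne_fin_two hab j with rfl | rfl
    · exact hi.1
    · exact hi.2
  have hd1 : ∀ i, |x i - y' a| = |σ * (x i - c)| := fun i => by
    rw [hy'a, abs_mul, hσabs, one_mul]
  have hd2 : ∀ i, |x i - y' b| = |σ * (x i - c) - ε| := fun i => by
    have : σ * (x i - c) - ε = σ * (x i - (c + σ * ε)) := by linear_combination ε * hσσ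
    rw [hy'b, this, abs_mul, hσabs, one_mul]
  have hmain := le_welfare_of_split (u := fun i => σ * (x i - c)) hε (hA.disjoint a b hab) (T := T)
    (by rw [hTcard, hA.card_eq hi₀, hA.card_eq hi₀])
    (fun i hi => by
      rcases hA.blocked_or a i hi with h | ⟨k, hk, hd⟩
      · exact Or.inl fun k hk => by simpa only [hd1] using (h.2 k hk).dist_le
      · rcases eq_or_eq_of_ne_fin_two hab k with rfl | rfl
        · exact absurd hk hi
        · exact Or.inr ⟨hk, by simpa only [hd1, hd2] using hd⟩)
    (fun i hi => by
      rcases hA.blocked_or b i hi with h | ⟨k, hk, hd⟩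
      · exact Or.inl fun k hk => by simpa only [hd2] using (h.2 k hk).dist_le
      · rcases eq_or_eq_of_ne_fin_two hab k with rfl | rfl
        · exact Or.inr ⟨hk, by simpa only [hd1, hd2] using hd⟩
        · exact absurd hk hi)
    (fun t ht i hi => by
      simp only [abs_mul, hσabs, one_mul]
      exact hT' t ht i hi)
    hwin' hside
  rw [hA.card_eq hi₀, hA.card_eq hi₀] at hmain
  calc nashWelfare q tie x y
        + ENNReal.ofReal (ε * ((min ⌊q a * (n : ℝ)⌋₊ ⌊q b * (n : ℝ)⌋₊ : ℕ) - 10 * τ))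
      ≤ ENNReal.ofReal (∑ i ∈ T, (1 - |x i - c|))
        + ENNReal.ofReal (ε * ((min ⌊q a * (n : ℝ)⌋₊ ⌊q b * (n : ℝ)⌋₊ : ℕ) - 10 * τ)) := by
        gcongr
    _ = ENNReal.ofReal (∑ i ∈ T, (1 - |x i - c|)
          + ε * ((min ⌊q a * (n : ℝ)⌋₊ ⌊q b * (n : ℝ)⌋₊ : ℕ) - 10 * τ)) := by
        rw [ENNReal.ofReal_add]
        · exact Finset.sum_nonneg fun i _ => by linarith [abs_sub_le_one_of_mem_Icc (hx i) hc]
        · exact mul_nonneg hε.le (by linarith)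
    _ ≤ ENNReal.ofReal (∑ j, ∑ i ∈ A j, (1 - |x i - y' j|)) := by
        refine ENNReal.ofReal_le_ofReal ?_
        rw [sum_fin_two_of_ne hab]
        simp only [hd1, hd2]
        refine le_trans (le_of_eq ?_) hmain
        simp only [abs_mul, hσabs, one_mul]
    _ ≤ nashWelfare q tie x y' :=
        hA.le_nashWelfare fun i j => abs_sub_le_one_of_mem_Icc (hx i) (hy' j)
    _ ≤ optWelfare q tie x := nashWelfare_le_optWelfare hy'

/-- Placing both facilities at the same percentile is not asymptotically optimal. -/
theorem not_isAsymptoticallyOptimal_of_eq {μ : Measure ℝ} {f : ℝ → ℝ}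
    (hμ : HasContinuousDensity μ f) {q : Fin 2 → ℝ} (hq : ∀ j, 0 < q j) (hq' : ∑ j, q j < 1)
    {tie : ∀ n : ℕ, Fin 2 → Equiv.Perm (Fin n)} {p : Fin 2 → ℝ} {a b : Fin 2} (hab : a ≠ b)
    (hp : p a = p b) : ¬ IsAsymptoticallyOptimal μ q tie p := by
  obtain ⟨M, hM, hL⟩ := hμ.exists_lipschitz
  rw [sum_fin_two_of_ne hab] at hq'
  set r := min (q a) (q b) with hr
  have hr0 : 0 < r := lt_min (hq a) (hq b)
  -- A window of length `2 * ε` has mass at most `r / 80`, and sampling adds another `r / 80`. So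
  -- `10 * τ` is `n * r / 4`, half of the lower bound `n * r / 2` for the smaller capacity.
  set ε := r / (160 * M) with hε
  have hε0 : 0 < ε := by positivity
  refine not_isAsymptoticallyOptimal_of_gain hμ (κ := ε * (r / 4)) (δ := r / 80) (by positivity)
    (by positivity) ?_
  obtain ⟨n₀, hn₀⟩ := exists_nat_gt (2 / r)
  filter_upwards [eventually_ge_atTop (n₀ + 1)] with n hn x hx
  have hn0 : 0 < n := by omega
  have hn' : (0 : ℝ) < n := by exact_mod_cast hn0
  have hnr : 2 < n * r := by
    rw [← div_lt_iff₀ hr0]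
    exact hn₀.trans_le (by exact_mod_cast (by omega : n₀ ≤ n))
  have hmin : n * r / 2 ≤ (min ⌊q a * (n : ℝ)⌋₊ ⌊q b * (n : ℝ)⌋₊ : ℕ) := by
    have h1 := Nat.lt_floor_add_one (q a * (n : ℝ))
    have h2 := Nat.lt_floor_add_one (q b * (n : ℝ))
    have h3 : r * n ≤ q a * n := by gcongr; exact min_le_left _ _
    have h4 : r * n ≤ q b * n := by gcongr; exact min_le_right _ _
    rw [Nat.cast_min]
    refine le_min ?_ ?_ <;> linarith
  have hwin : ∀ s, ((Finset.univ.filter fun i => x i ∈ Icc s (s + 2 * ε)).card : ℝ)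
      ≤ r / 40 * n := by
    intro s
    have h1 := (abs_le.1 (hx.2 s (s + 2 * ε) (by linarith))).2
    have h2 := hL s (s + 2 * ε) (by linarith)
    have h3 : M * (s + 2 * ε - s) = r / 80 := by
      rw [hε]
      field_simp
      ring
    rw [h3] at h2
    nlinarith
  have hgain := nashWelfare_add_le_of_coincident (q := q) (tie := tie n) hx.1 hab
    (y := percentileMechanism p x) rfl
    (by simp only [percentileMechanism, hp]) (percentileMechanism_mem_Icc hx.1 a)
    (floor_add_floor_lt (hq a) (hq b) hq' hn0) hε0 hwin (by linarith)
    (by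
      have : (0 : ℝ) < (min ⌊q a * (n : ℝ)⌋₊ ⌊q b * (n : ℝ)⌋₊ : ℕ) :=
        lt_of_lt_of_le (by positivity) hmin
      exact_mod_cast this)
  refine le_trans (add_le_add le_rfl (ENNReal.ofReal_le_ofReal ?_)) hgain
  rw [mul_assoc]
  refine mul_le_mul_of_nonneg_left ?_ hε0.le
  linarith

/-! ### Single-peaked densities -/

section SinglePeaked

variable {μ : Measure ℝ} {f : ℝ → ℝ} {c : ℝ}

/-- The peak is put at an endpoint, which leaves one of the two conditions on a single point. -/
theorem isSinglePeakedDensity_of_isMonotoneDensity (h : IsMonotoneDensity f) :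
    IsSinglePeakedDensity f := by
  rcases h with h | h
  · refine ⟨0, by simp, ?_, h⟩
    rw [Icc_self]
    exact strictMonoOn_singleton f
  · refine ⟨1, by simp, h, ?_⟩
    rw [Icc_self]
    exact strictAntiOn_singleton f

/-- Strict monotonicity from a nonnegative endpoint value makes `f` positive inside `(0,1)`. Being
single-peaked, `f` is bounded below on a subinterval by the smaller of its end values. -/
theorem HasContinuousDensity.measureReal_Iic_lt (hμ : HasContinuousDensity μ f)
    (hc : c ∈ Icc (0 : ℝ) 1) (hinc : StrictMonoOn f (Icc 0 c)) (hdec : StrictAntiOn f (Icc c 1))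
    {s t : ℝ} (hs : s < 1) (ht : 0 < t) (hst : s < t) : μ.real (Iic s) < μ.real (Iic t) := by
  have := hμ.isProbabilityMeasure
  have hpos : ∀ u ∈ Ioo (0 : ℝ) 1, 0 < f u := by
    intro u hu
    rcases le_total u c with h | h
    · exact lt_of_le_of_lt (hμ.nonneg 0 (by simp)) (hinc ⟨le_rfl, hc.1⟩ ⟨hu.1.le, h⟩ hu.1)
    · exact lt_of_le_of_lt (hμ.nonneg 1 (by simp)) (hdec ⟨h, hu.2.le⟩ ⟨hc.2, le_rfl⟩ hu.2)
  obtain ⟨s', hs1, hs2⟩ := exists_between (max_lt (lt_min hs hst) (lt_min zero_lt_one ht))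
  obtain ⟨t', ht1, ht2⟩ := exists_between hs2
  rw [max_lt_iff] at hs1
  rw [lt_min_iff] at hs2 ht2
  have hlow : ∀ u ∈ Ioc s' t', min (f s') (f t') ≤ f u := by
    intro u hu
    rcases le_total u c with h | h
    · exact (min_le_left _ _).trans (hinc.monotoneOn ⟨hs1.2.le, hu.1.le.trans h⟩
        ⟨hs1.2.le.trans hu.1.le, h⟩ hu.1.le)
    · exact (min_le_right _ _).trans (hdec.antitoneOn ⟨h, hu.2.trans ht2.1.le⟩
        ⟨h.trans hu.2, ht2.1.le⟩ hu.2)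
  have hmin : 0 < min (f s') (f t') :=
    lt_min (hpos s' ⟨hs1.2, hs2.1⟩) (hpos t' ⟨hs1.2.trans ht1, ht2.1⟩)
  have h1 := hμ.le_measureReal_Iic_sub hs1.2.le ht1.le ht2.1.le hlow hmin.le
  have h2 : 0 < min (f s') (f t') * (t' - s') := mul_pos hmin (by linarith)
  have h3 := measureReal_Iic_mono (μ := μ) hs1.1.le
  have h4 := measureReal_Iic_mono (μ := μ) ht2.2.le
  simp only at h3 h4
  linarith

/-- Left of the peak, a ball has more mass in its right half than in its left half. -/
theorem HasContinuousDensity.measure_left_lt_right (hμ : HasContinuousDensity μ f)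
    (hc : c ∈ Icc (0 : ℝ) 1) (hinc : StrictMonoOn f (Icc 0 c)) {α r : ℝ} (hα : 0 ≤ α) (hr : 0 < r)
    (h : α + r ≤ c) : μ.real (Iic α) - μ.real (Iic (α - r))
      < μ.real (Iic (α + r)) - μ.real (Iic α) := by
  have hα1 : α ∈ Icc (0 : ℝ) 1 := ⟨hα, by linarith [hc.2]⟩
  have hfα := hμ.nonneg α hα1
  -- The value `f α * r` separates the two halves. The ball may stick out of `[0,1]` on the left,
  -- where it has no mass, which only helps.
  have hleft : μ.real (Iic α) - μ.real (Iic (α - r)) ≤ f α * r := by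
    have hbound : ∀ s, 0 ≤ s → ∀ u ∈ Ioc s α, f u ≤ f α := fun s hs u hu =>
      hinc.monotoneOn ⟨hs.trans hu.1.le, hu.2.trans (by linarith)⟩ ⟨hα, by linarith⟩ hu.2
    rcases le_total 0 (α - r) with h' | h'
    · have := hμ.measureReal_Iic_sub_le h' (by linarith) hα1.2 (hbound _ h') hfα
      linarith
    · have := hμ.measureReal_Iic_sub_le le_rfl hα hα1.2 (hbound 0 le_rfl) hfα
      rw [hμ.measureReal_Iic_of_nonpos le_rfl] at this
      rw [hμ.measureReal_Iic_of_nonpos h']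
      nlinarith
  have h1 := hμ.le_measureReal_Iic_sub (s := α) (t := α + r / 2) (C := f α) hα (by linarith)
    (by linarith [hc.2]) (fun u hu => hinc.monotoneOn ⟨hα, by linarith⟩
      ⟨hα.trans hu.1.le, by linarith [hu.2]⟩ hu.1.le) hfα
  have hmid : f α < f (α + r / 2) :=
    hinc ⟨hα, by linarith⟩ ⟨by linarith, by linarith⟩ (by linarith)
  have h2 := hμ.le_measureReal_Iic_sub (s := α + r / 2) (t := α + r) (C := f (α + r / 2))
    (by linarith) (by linarith) (by linarith [hc.2]) (fun u hu => hinc.monotoneOn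
      ⟨by linarith, by linarith⟩ ⟨by linarith [hu.1], by linarith [hu.2]⟩ hu.1.le) (by linarith)
  nlinarith

/-- Right of the peak, a ball has more mass in its left half than in its right half. -/
theorem HasContinuousDensity.measure_right_lt_left (hμ : HasContinuousDensity μ f)
    (hc : c ∈ Icc (0 : ℝ) 1) (hdec : StrictAntiOn f (Icc c 1)) {β r : ℝ} (hβ : β ≤ 1) (hr : 0 < r)
    (h : c ≤ β - r) : μ.real (Iic (β + r)) - μ.real (Iic β)
      < μ.real (Iic β) - μ.real (Iic (β - r)) := by
  have hβ1 : β ∈ Icc (0 : ℝ) 1 := ⟨by linarith [hc.1], hβ⟩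
  have hfβ := hμ.nonneg β hβ1
  have hright : μ.real (Iic (β + r)) - μ.real (Iic β) ≤ f β * r := by
    have hbound : ∀ t, t ≤ 1 → ∀ u ∈ Ioc β t, f u ≤ f β := fun t ht u hu =>
      hdec.antitoneOn ⟨by linarith, hβ⟩ ⟨by linarith [hu.1], hu.2.trans ht⟩ hu.1.le
    rcases le_total (β + r) 1 with h' | h'
    · have := hμ.measureReal_Iic_sub_le hβ1.1 (by linarith) h' (hbound _ h') hfβ
      linarith
    · have := hμ.measureReal_Iic_sub_le hβ1.1 hβ le_rfl (hbound 1 le_rfl) hfβ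
      rw [hμ.measureReal_Iic_of_one_le le_rfl] at this
      rw [hμ.measureReal_Iic_of_one_le h']
      nlinarith
  have h1 := hμ.le_measureReal_Iic_sub (s := β - r / 2) (t := β) (C := f β)
    (by linarith [hc.1]) (by linarith) hβ (fun u hu => hdec.antitoneOn
      ⟨by linarith [hu.1], hu.2.trans hβ⟩ ⟨by linarith, hβ⟩ hu.2) hfβ
  have hmid : f β < f (β - r / 2) :=
    hdec ⟨by linarith, by linarith⟩ ⟨by linarith, hβ⟩ (by linarith)
  have h2 := hμ.le_measureReal_Iic_sub (s := β - r) (t := β - r / 2) (C := f (β - r / 2))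
    (by linarith [hc.1]) (by linarith) (by linarith) (fun u hu => hdec.antitoneOn
      ⟨by linarith [hu.1], by linarith [hu.2]⟩ ⟨by linarith, by linarith⟩ hu.2) (by linarith)
  nlinarith

theorem HasContinuousDensity.exists_quantile (hμ : HasContinuousDensity μ f) {p : ℝ}
    (hp : p ∈ Icc (0 : ℝ) 1) : ∃ α ∈ Icc (0 : ℝ) 1, μ.real (Iic α) = p := by
  have h := intermediate_value_Icc (zero_le_one (α := ℝ)) hμ.continuous_measureReal_Iic.continuousOn
  simp only [hμ.measureReal_Iic_of_nonpos le_rfl, hμ.measureReal_Iic_of_one_le le_rfl] at h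
  exact h hp

/-- The intermediate value theorem applies because the ball of radius `1` around a point of `[0,1]`
has full mass. -/
theorem HasContinuousDensity.exists_radius (hμ : HasContinuousDensity μ f) {α p : ℝ}
    (hα : α ∈ Icc (0 : ℝ) 1) (hp0 : 0 < p) (hp1 : p ≤ 1) :
    ∃ r > 0, μ.real (Iic (α + r)) - μ.real (Iic (α - r)) = p := by
  have hcont : Continuous fun r => μ.real (Iic (α + r)) - μ.real (Iic (α - r)) :=
    (hμ.continuous_measureReal_Iic.comp (by fun_prop : Continuous fun r => α + r)).sub
      (hμ.continuous_measureReal_Iic.comp (by fun_prop : Continuous fun r => α - r))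
  have h := intermediate_value_Icc (zero_le_one (α := ℝ)) hcont.continuousOn
  simp only [add_zero, sub_zero, sub_self,
    hμ.measureReal_Iic_of_nonpos (by linarith [hα.2] : α - 1 ≤ 0),
    hμ.measureReal_Iic_of_one_le (by linarith [hα.1] : 1 ≤ α + 1)] at h
  obtain ⟨r, hr, hrp⟩ := h ⟨hp0.le, hp1⟩
  refine ⟨r, lt_of_le_of_ne hr.1 ?_, hrp⟩
  rintro rfl
  simp only [add_zero, sub_zero, sub_self] at hrp
  exact hp0.ne hrp

/-- If the mass between two points is at least the mass of the balls around them, these balls do not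
touch. -/
theorem HasContinuousDensity.balls_separated (hμ : HasContinuousDensity μ f)
    (hc : c ∈ Icc (0 : ℝ) 1) (hinc : StrictMonoOn f (Icc 0 c)) (hdec : StrictAntiOn f (Icc c 1))
    {α β r s qa qb : ℝ} (hα : α ∈ Icc (0 : ℝ) 1) (hβ : β ∈ Icc (0 : ℝ) 1) (hr : 0 < r) (hs : 0 < s)
    (hra : μ.real (Iic (α + r)) - μ.real (Iic (α - r)) = qa)
    (hsb : μ.real (Iic (β + s)) - μ.real (Iic (β - s)) = qb) (hq : qa + qb < 1)
    (hmass : qa + qb ≤ μ.real (Iic β) - μ.real (Iic α)) : α + r < β - s := by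
  have := hμ.isProbabilityMeasure
  by_contra! hcon
  have h1 := measureReal_Iic_mono (μ := μ) hcon
  have h2 := measureReal_Iic_mono (μ := μ) (by linarith : α - r ≤ α)
  have h3 := measureReal_Iic_mono (μ := μ) (by linarith : β ≤ β + s)
  simp only at h1 h2 h3
  -- Touching balls would cover `[α - r, β + s]`, so their total mass would be at least that between
  -- `α` and `β`. The hypothesis then forces equality, with no mass beyond `α` and `β`; these are
  -- the ends of `[0,1]`, and the mass would be `1`.
  have hα0 : α ≤ 0 := by
    by_contra! h
    have := hμ.measureReal_Iic_lt hc hinc hdec (s := α - r) (t := α) (by linarith [hα.2]) h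
      (by linarith)
    linarith
  have hβ1 : 1 ≤ β := by
    by_contra! h
    have := hμ.measureReal_Iic_lt hc hinc hdec (s := β) (t := β + s) h (by linarith [hβ.1])
      (by linarith)
    linarith
  have e1 := hμ.measureReal_Iic_of_nonpos hα0
  have e2 := hμ.measureReal_Iic_of_one_le hβ1
  linarith

end SinglePeaked

/-! ### Facilities that do not compete for agents -/

section Sorted

variable {n : ℕ}

theorem card_filter_comp_sort (x : Fin n → ℝ) (t : ℝ) :
    (Finset.univ.filter fun l => x (Tuple.sort x l) ≤ t).card
      = (Finset.univ.filter fun i => x i ≤ t).card := by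
  refine Finset.card_bij (fun l _ => Tuple.sort x l) ?_ ?_ ?_
  · intro l hl
    simpa using hl
  · intro l _ l' _ h
    exact (Tuple.sort x).injective h
  · intro i hi
    exact ⟨(Tuple.sort x).symm i, by simpa using hi, by simp⟩

theorem card_le_of_lt_sort (x : Fin n → ℝ) {k : Fin n} {t : ℝ} (h : t < x (Tuple.sort x k)) :
    (Finset.univ.filter fun i => x i ≤ t).card ≤ k := by
  rw [← card_filter_comp_sort, ← Fin.card_Iio k]
  refine Finset.card_le_card fun l hl => ?_
  simp only [Finset.mem_filter, Finset.mem_univ, true_and] at hl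
  rw [Finset.mem_Iio]
  by_contra! hkl
  have := Tuple.monotone_sort x hkl
  simp only [Function.comp_apply] at this
  linarith

theorem lt_card_of_sort_le (x : Fin n → ℝ) {k : Fin n} {t : ℝ} (h : x (Tuple.sort x k) ≤ t) :
    (k : ℕ) < (Finset.univ.filter fun i => x i ≤ t).card := by
  rw [← card_filter_comp_sort, Nat.lt_iff_add_one_le, ← Fin.card_Iic k]
  refine Finset.card_le_card fun l hl => ?_
  simp only [Finset.mem_filter, Finset.mem_univ, true_and]
  exact (Tuple.monotone_sort x (Finset.mem_Iic.1 hl)).trans h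

end Sorted

theorem IsTypicalSample.mono {μ : Measure ℝ} {δ δ' : ℝ} (h : δ ≤ δ') {n : ℕ} {x : Fin n → ℝ}
    (hx : IsTypicalSample μ δ x) : IsTypicalSample μ δ' x :=
  ⟨hx.1, fun s t hst => (hx.2 s t hst).trans (by gcongr)⟩

/-! ### Facility positions and full balls on typical samples -/

section Single

variable {μ : Measure ℝ} {f : ℝ → ℝ} {c : ℝ}

/-- On typical samples the percentile mechanism places a facility close to the quantile. -/
theorem exists_percentileMechanism_near (hμ : HasContinuousDensity μ f)
    (hc : c ∈ Icc (0 : ℝ) 1) (hinc : StrictMonoOn f (Icc 0 c)) (hdec : StrictAntiOn f (Icc c 1))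
    {m : ℕ} {p : Fin m → ℝ} {j : Fin m} (hp : p j ∈ Icc (0 : ℝ) 1) {α : ℝ}
    (hα : α ∈ Icc (0 : ℝ) 1) (hαp : μ.real (Iic α) = p j) {η : ℝ} (hη : 0 < η) :
    ∃ δ > 0, ∀ᶠ n : ℕ in atTop, ∀ x : Fin n → ℝ, IsTypicalSample μ δ x →
      |percentileMechanism p x j - α| ≤ η := by
  have := hμ.isProbabilityMeasure
  obtain ⟨δ₁, hδ₁, hup⟩ : ∃ δ > 0, α + η < 1 → p j + δ < μ.real (Iic (α + η)) := by
    by_cases h : α + η < 1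
    · have h1 := hμ.measureReal_Iic_lt hc hinc hdec (s := α) (t := α + η) (by linarith)
        (by linarith [hα.1]) (by linarith)
      obtain ⟨d, hd1, hd2⟩ := exists_between h1
      exact ⟨d - p j, by linarith, fun _ => by linarith⟩
    · exact ⟨1, one_pos, fun h' => absurd h' h⟩
  -- One `δ` pays for the sampling error, the other for using `n - 1` instead of `n` in the index.
  -- If `α - η ≤ 0`, the facility cannot be farther left anyway.
  obtain ⟨δ₂, hδ₂, hlo⟩ : ∃ δ > 0, 0 < α - η → μ.real (Iic (α - η)) + 2 * δ < p j := by
    by_cases h : 0 < α - η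
    · have h1 := hμ.measureReal_Iic_lt hc hinc hdec (s := α - η) (t := α) (by linarith [hα.2])
        (by linarith) (by linarith)
      obtain ⟨d, hd1, hd2⟩ := exists_between h1
      exact ⟨(p j - d) / 2, by linarith, fun _ => by linarith⟩
    · exact ⟨1, one_pos, fun h' => absurd h' h⟩
  refine ⟨min δ₁ δ₂, lt_min hδ₁ hδ₂, ?_⟩
  obtain ⟨n₀, hn₀⟩ := exists_nat_gt (1 / δ₂)
  filter_upwards [eventually_ge_atTop (n₀ + 1)] with n hn x hx
  have hn0 : 0 < n := by omega
  have hn' : (0 : ℝ) < n := by exact_mod_cast hn0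
  have hn1 : (1 : ℝ) ≤ n := by exact_mod_cast hn0
  have hnδ : 1 < n * δ₂ := by
    rw [← div_lt_iff₀ hδ₂]
    exact hn₀.trans_le (by exact_mod_cast (by omega : n₀ ≤ n))
  have hidx := percentile_index_lt hn0 hp
  have hfl1 : (⌊p j * ((n : ℝ) - 1)⌋₊ : ℝ) ≤ p j * ((n : ℝ) - 1) :=
    Nat.floor_le (mul_nonneg hp.1 (by linarith))
  have hfl2 := Nat.lt_floor_add_one (p j * ((n : ℝ) - 1))
  have hy : percentileMechanism p x j = x (Tuple.sort x ⟨⌊p j * ((n : ℝ) - 1)⌋₊, hidx⟩) :=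
    dif_pos hidx
  have hyI := percentileMechanism_mem_Icc (p := p) hx.1 j
  have hcount : ∀ t, 0 ≤ t → |((Finset.univ.filter fun i => x i ≤ t).card : ℝ)
      - n * μ.real (Iic t)| ≤ min δ₁ δ₂ * n := by
    intro t ht
    have h1 := hx.2 0 t ht
    rw [hμ.measureReal_Iic_of_nonpos le_rfl, sub_zero] at h1
    have h2 : (Finset.univ.filter fun i => x i ∈ Icc 0 t)
        = Finset.univ.filter fun i => x i ≤ t :=
      Finset.filter_congr fun i _ => ⟨fun h => h.2, fun h => ⟨(hx.1 i).1, h⟩⟩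
    rwa [h2] at h1
  rw [abs_le]
  constructor
  · by_contra! hcon
    have hpos : 0 < α - η := by linarith [hyI.1]
    have h1 := lt_card_of_sort_le x (k := ⟨⌊p j * ((n : ℝ) - 1)⌋₊, hidx⟩) (t := α - η)
      (by rw [← hy]; linarith)
    have h2 : (⌊p j * ((n : ℝ) - 1)⌋₊ : ℝ) + 1 ≤ (Finset.univ.filter fun i => x i ≤ α - η).card := by
      exact_mod_cast h1
    have h3 := (abs_le.1 (hcount (α - η) hpos.le)).2
    have h4 := hlo hpos
    have h5 : min δ₁ δ₂ * n ≤ δ₂ * n := by gcongr; exact min_le_right _ _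
    nlinarith [hp.2]
  · by_contra! hcon
    have hlt : α + η < 1 := by linarith [hyI.2]
    have h1 := card_le_of_lt_sort x (k := ⟨⌊p j * ((n : ℝ) - 1)⌋₊, hidx⟩) (t := α + η)
      (by rw [← hy]; linarith)
    have h2 : ((Finset.univ.filter fun i => x i ≤ α + η).card : ℝ) ≤ ⌊p j * ((n : ℝ) - 1)⌋₊ := by
      exact_mod_cast h1
    have h3 := (abs_le.1 (hcount (α + η) (by linarith [hα.1]))).1
    have h4 := hup hlt
    have h5 : min δ₁ δ₂ * n ≤ δ₁ * n := by gcongr; exact min_le_left _ _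
    nlinarith [hp.1]

/-- On typical samples a slightly larger ball contains enough agents to fill a facility. -/
theorem exists_floor_le_card_ball (hμ : HasContinuousDensity μ f)
    (hc : c ∈ Icc (0 : ℝ) 1) (hinc : StrictMonoOn f (Icc 0 c)) (hdec : StrictAntiOn f (Icc c 1))
    {α r ρ : ℝ} (hα : α ∈ Icc (0 : ℝ) 1) (hr : 0 < r) (hρ : ρ < 1)
    (hmass : μ.real (Iic (α + r)) - μ.real (Iic (α - r)) = ρ) {η : ℝ} (hη : 0 < η) :
    ∃ δ > 0, ∀ (n : ℕ) (x : Fin n → ℝ), IsTypicalSample μ δ x → ∀ y η', |y - α| ≤ η' →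
      ⌊ρ * (n : ℝ)⌋₊ ≤ (Finset.univ.filter fun i => |x i - y| ≤ r + η + η').card := by
  have := hμ.isProbabilityMeasure
  -- Since `ρ < 1`, the ball does not cover `[0,1]`, so enlarging it adds mass at one end at least.
  have hlt : ρ < μ.real (Iic (α + r + η)) - μ.real (Iic (α - r - η)) := by
    have m1 := measureReal_Iic_mono (μ := μ) (by linarith : α + r ≤ α + r + η)
    have m2 := measureReal_Iic_mono (μ := μ) (by linarith : α - r - η ≤ α - r)
    simp only at m1 m2
    rcases lt_or_ge (α + r) 1 with h | h
    · have := hμ.measureReal_Iic_lt hc hinc hdec (s := α + r) (t := α + r + η) h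
        (by linarith [hα.1]) (by linarith)
      linarith
    · rcases lt_or_ge 0 (α - r) with h' | h'
      · have := hμ.measureReal_Iic_lt hc hinc hdec (s := α - r - η) (t := α - r)
          (by linarith [hα.2]) h' (by linarith)
        linarith
      · rw [hμ.measureReal_Iic_of_one_le h, hμ.measureReal_Iic_of_nonpos h'] at hmass
        linarith
  obtain ⟨d, hd1, hd2⟩ := exists_between hlt
  refine ⟨d - ρ, by linarith, fun n x hx y η' hy => ?_⟩
  have h1 := (abs_le.1 (hx.2 (α - r - η) (α + r + η) (by linarith))).1
  have h2 : ((Finset.univ.filter fun i => x i ∈ Icc (α - r - η) (α + r + η)).card : ℝ)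
      ≤ (Finset.univ.filter fun i => |x i - y| ≤ r + η + η').card := by
    refine Nat.cast_le.2 (Finset.card_le_card fun i hi => ?_)
    simp only [Finset.mem_filter, Finset.mem_univ, true_and, mem_Icc] at hi ⊢
    rw [abs_le] at hy ⊢
    constructor <;> linarith [hi.1, hi.2, hy.1, hy.2]
  have hn : (0 : ℝ) ≤ n := Nat.cast_nonneg n
  refine Nat.floor_le_of_le ?_
  nlinarith

end Single

/-- The agents that a facility serves first lie in each ball that contains enough agents. -/
theorem dist_le_of_mem_first {n m : ℕ} {tie : Fin m → Equiv.Perm (Fin n)} {x : Fin n → ℝ}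
    {y : Fin m → ℝ} {j : Fin m} {S : Finset (Fin n)} {R : ℝ}
    (hS : ∀ a ∈ S, ∀ b ∈ Finset.univ, b ∉ S → Precedes tie x y j a b)
    (hR : S.card ≤ (Finset.univ.filter fun i => |x i - y j| ≤ R).card) {i : Fin n} (hi : i ∈ S) :
    |x i - y j| ≤ R := by
  by_contra! hcon
  have hsub : (Finset.univ.filter fun i => |x i - y j| ≤ R) ⊆ S.erase i := by
    intro b hb
    simp only [Finset.mem_filter, Finset.mem_univ, true_and] at hb
    rw [Finset.mem_erase]
    refine ⟨?_, ?_⟩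
    · rintro rfl
      linarith
    · by_contra hbS
      have := (hS i hi b (Finset.mem_univ b) hbS).dist_le
      linarith
  have h1 := Finset.card_le_card hsub
  have h2 := Finset.card_erase_lt_of_mem hi
  omega

/-- Moving one of two facilities that do not compete for agents by `ε`. -/
theorem nashWelfare_add_le_of_separated {n : ℕ} {q : Fin 2 → ℝ}
    {tie : Fin 2 → Equiv.Perm (Fin n)} {x : Fin n → ℝ} (hx : ∀ i, x i ∈ Icc (0 : ℝ) 1)
    {y : Fin 2 → ℝ} (hy : ∀ j, y j ∈ Icc (0 : ℝ) 1) {a b : Fin 2} (hab : a ≠ b)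
    (hcap : ⌊q a * (n : ℝ)⌋₊ + ⌊q b * (n : ℝ)⌋₊ ≤ n)
    {σ ε R R' Q g : ℝ} (hσ : σ = 1 ∨ σ = -1) (hε : 0 < ε) (hg : 0 ≤ g)
    (hnew : y a + σ * ε ∈ Icc (0 : ℝ) 1)
    (hR : ⌊q a * (n : ℝ)⌋₊ ≤ (Finset.univ.filter fun i => |x i - y a| ≤ R).card)
    (hR' : ⌊q a * (n : ℝ)⌋₊ ≤ (Finset.univ.filter fun i => |x i - (y a + σ * ε)| ≤ R').card)
    (hQ : ⌊q b * (n : ℝ)⌋₊ ≤ (Finset.univ.filter fun i => |x i - y b| ≤ Q).card)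
    (hsep : R' + Q < |y a + σ * ε - y b|)
    (hbad : 2 * ((Finset.univ.filter fun i => |x i - y a| ≤ R ∧ σ * (x i - y a) < ε).card : ℝ) + g
      ≤ ⌊q a * (n : ℝ)⌋₊) :
    nashWelfare q tie x y + ENNReal.ofReal (ε * g) ≤ optWelfare q tie x := by
  have hσabs : |σ| = 1 := by rcases hσ with rfl | rfl <;> norm_num
  have hσσ : σ * σ = 1 := by rcases hσ with rfl | rfl <;> norm_num
  have hd0 : ∀ i j, 0 ≤ 1 - |x i - y j| := fun i j => by
    linarith [abs_sub_le_one_of_mem_Icc (hx i) (hy j)]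
  obtain ⟨y', hy'a, hy'b⟩ : ∃ y' : Fin 2 → ℝ, y' a = y a + σ * ε ∧ y' b = y b :=
    ⟨fun j => if j = a then y a + σ * ε else y b, if_pos rfl, if_neg hab.symm⟩
  have hy' : ∀ j, y' j ∈ Icc (0 : ℝ) 1 := by
    intro j
    rcases eq_or_eq_of_ne_fin_two hab j with rfl | rfl
    · rwa [hy'a]
    · rw [hy'b]
      exact hy _
  obtain ⟨S, -, hSc, hS⟩ := exists_first_subset tie x y a Finset.univ (c := ⌊q a * (n : ℝ)⌋₊)
    (by rw [Finset.card_univ, Fintype.card_fin]; omega)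
  obtain ⟨S', -, hSc', hS'⟩ := exists_first_subset tie x y' a Finset.univ (c := ⌊q a * (n : ℝ)⌋₊)
    (by rw [Finset.card_univ, Fintype.card_fin]; omega)
  obtain ⟨B, -, hBc, hB⟩ := exists_first_subset tie x y' b Finset.univ (c := ⌊q b * (n : ℝ)⌋₊)
    (by rw [Finset.card_univ, Fintype.card_fin]; omega)
  have hdisj : Disjoint S' B := by
    rw [Finset.disjoint_left]
    intro i hi hi'
    have h1 := dist_le_of_mem_first hS' (by rw [hSc', hy'a]; exact hR') hi
    have h2 := dist_le_of_mem_first hB (by rw [hBc, hy'b]; exact hQ) hi'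
    rw [hy'a] at h1
    rw [hy'b] at h2
    have h3 := abs_sub_le (y a + σ * ε) (x i) (y b)
    rw [abs_sub_comm _ (x i)] at h3
    linarith
  -- Before the move, the agents nearest to each facility bound the welfare whether or not `S` and
  -- `B` are disjoint; disjointness matters only after it.
  have hold : nashWelfare q tie x y
      ≤ ENNReal.ofReal (∑ i ∈ S, (1 - |x i - y a|) + ∑ i ∈ B, (1 - |x i - y b|)) := by
    refine nashWelfare_le_ofReal fun A _ hA => ?_
    rw [sum_fin_two_of_ne hab]
    refine add_le_add (sum_le_sum_of_dominates (fun i _ => hd0 i a) (fun t ht i _ hi => ?_) ?_)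
      (sum_le_sum_of_dominates (fun i _ => hd0 i b) (fun t ht i _ hi => ?_) ?_)
    · linarith [(hS t ht i (Finset.mem_univ i) hi).dist_le]
    · rw [hSc]; exact hA a
    · have := (hB t ht i (Finset.mem_univ i) hi).dist_le
      rw [hy'b] at this
      linarith
    · rw [hBc]; exact hA b
  -- With `S` kept fixed, agents at least `ε` ahead in direction `σ` gain `ε`, and all others lose
  -- at most `ε`.
  have hmove : ∑ i ∈ S, (1 - |x i - y a|) + ε * g ≤ ∑ i ∈ S, (1 - |x i - y' a|) := by
    have e0 : ((S.filter fun i => σ * (x i - y a) < ε).card : ℝ)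
        ≤ (Finset.univ.filter fun i => |x i - y a| ≤ R ∧ σ * (x i - y a) < ε).card := by
      refine Nat.cast_le.2 (Finset.card_le_card fun i hi => ?_)
      simp only [Finset.mem_filter, Finset.mem_univ, true_and] at hi ⊢
      exact ⟨dist_le_of_mem_first hS (by rw [hSc]; exact hR) hi.1, hi.2⟩
    have e1 : ε * g ≤ ∑ i ∈ S, (ε - if σ * (x i - y a) < ε then 2 * ε else 0) := by
      rw [Finset.sum_sub_distrib, ← Finset.sum_filter, Finset.sum_const, Finset.sum_const,
        nsmul_eq_mul, nsmul_eq_mul, hSc]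
      nlinarith
    refine le_trans (add_le_add le_rfl e1) ?_
    rw [← Finset.sum_add_distrib]
    refine Finset.sum_le_sum fun i _ => ?_
    have d1 : |x i - y a| = |σ * (x i - y a)| := by rw [abs_mul, hσabs, one_mul]
    have d2 : |x i - y' a| = |σ * (x i - y a) - ε| := by
      have : σ * (x i - y a) - ε = σ * (x i - (y a + σ * ε)) := by linear_combination ε * hσσ
      rw [hy'a, this, abs_mul, hσabs, one_mul]
    rw [d1, d2]
    split_ifs with h
    · have := abs_sub (σ * (x i - y a)) ε
      rw [abs_of_pos hε] at this
      linarith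
    · push Not at h
      rw [abs_of_nonneg (by linarith : 0 ≤ σ * (x i - y a) - ε),
        abs_of_nonneg (by linarith : 0 ≤ σ * (x i - y a))]
      linarith
  have hbest : ∑ i ∈ S, (1 - |x i - y' a|) ≤ ∑ i ∈ S', (1 - |x i - y' a|) := by
    refine sum_le_sum_of_dominates (fun i _ => ?_) (fun t ht i _ hi => ?_) (by rw [hSc, hSc'])
    · linarith [abs_sub_le_one_of_mem_Icc (hx i) (hy' a)]
    · linarith [(hS' t ht i (Finset.mem_univ i) hi).dist_le]
  obtain ⟨A, hA, hAa, hAb⟩ := isStableAssignment_fin_two (q := q) (tie := tie) (x := x) (y := y')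
    hab hdisj hSc' hBc (fun i hi => Or.inl fun k hk => hS' k hk i (Finset.mem_univ i) hi)
    (fun i hi => Or.inl fun k hk => hB k hk i (Finset.mem_univ i) hi)
  calc nashWelfare q tie x y + ENNReal.ofReal (ε * g)
      ≤ ENNReal.ofReal (∑ i ∈ S, (1 - |x i - y a|) + ∑ i ∈ B, (1 - |x i - y b|))
        + ENNReal.ofReal (ε * g) := by gcongr
    _ = ENNReal.ofReal (∑ i ∈ S, (1 - |x i - y a|) + ∑ i ∈ B, (1 - |x i - y b|) + ε * g) := by
        rw [ENNReal.ofReal_add (add_nonneg (Finset.sum_nonneg fun i _ => hd0 i a)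
          (Finset.sum_nonneg fun i _ => hd0 i b)) (mul_nonneg hε.le hg)]
    _ ≤ ENNReal.ofReal (∑ j, ∑ i ∈ A j, (1 - |x i - y' j|)) := by
        refine ENNReal.ofReal_le_ofReal ?_
        rw [sum_fin_two_of_ne hab, hAa, hAb, hy'b]
        linarith
    _ ≤ nashWelfare q tie x y' :=
        hA.le_nashWelfare fun i j => abs_sub_le_one_of_mem_Icc (hx i) (hy' j)
    _ ≤ optWelfare q tie x := nashWelfare_le_optWelfare hy'

/-! ### Displacing an unbalanced facility -/

section Single

variable {μ : Measure ℝ} {f : ℝ → ℝ} {c : ℝ}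

/-- Moving a facility whose agents lie mostly on the side of the other one towards it. -/
theorem IsTypicalSample.nashWelfare_add_le {M : ℝ}
    (hL : ∀ s t, s ≤ t → μ.real (Iic t) - μ.real (Iic s) ≤ M * (t - s)) {n : ℕ} {q : Fin 2 → ℝ}
    {tie : Fin 2 → Equiv.Perm (Fin n)} {x : Fin n → ℝ} {y : Fin 2 → ℝ}
    (hyI : ∀ j, y j ∈ Icc (0 : ℝ) 1) {a b : Fin 2} (hab : a ≠ b)
    (hcap : ⌊q a * (n : ℝ)⌋₊ + ⌊q b * (n : ℝ)⌋₊ ≤ n) {α β r s η D δ : ℝ} (hr : 0 < r)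
    (hη0 : 0 < η) (hx : IsTypicalSample μ δ x) (hya : |y a - α| ≤ η) (hyb : |y b - β| ≤ η)
    (h₃ : ∀ z η', |z - α| ≤ η' →
      ⌊q a * (n : ℝ)⌋₊ ≤ (Finset.univ.filter fun i => |x i - z| ≤ r + η + η').card)
    (h₄ : ∀ z η', |z - β| ≤ η' →
      ⌊q b * (n : ℝ)⌋₊ ≤ (Finset.univ.filter fun i => |x i - z| ≤ s + η + η').card) {σ l h : ℝ}
    (hσ : (σ = 1 ∧ l = α - r ∧ h = α) ∨ (σ = -1 ∧ l = α ∧ h = α + r)) (hs : 0 < s)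
    (hηg : η < (σ * (β - α) - r - s) / 8) (hηD : η * (48 * M) < D) (hδD : δ < D / 8)
    (hD0 : 0 < D) (hD : D = q a - 2 * (μ.real (Iic h) - μ.real (Iic l))) (hnD : 4 < n * D) :
    nashWelfare q tie x y + ENNReal.ofReal (η * (D / 4) * n) ≤ optWelfare q tie x := by
  have hn' : (0 : ℝ) ≤ n := Nat.cast_nonneg n
  have hya' := abs_le.1 hya
  have hyb' := abs_le.1 hyb
  have hσ' : σ = 1 ∨ σ = -1 := by
    rcases hσ with h | h
    · exact Or.inl h.1
    · exact Or.inr h.1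
  have hdist : σ * (β - α) - 3 * η
      ≤ σ * (y b - (y a + σ * η)) := by
    rcases hσ' with rfl | rfl <;> linarith [hya'.1, hya'.2, hyb'.1, hyb'.2]
  have hmoved : |y a + σ * η - α| ≤ 2 * η := by
    rw [abs_le]
    rcases hσ' with rfl | rfl <;> constructor <;> linarith [hya'.1, hya'.2]
  -- The agents that may lose lie in the outer half `[l, h]` of the ball, widened by `3 * η`: `2 *
  -- η` from the radius and `η` from the position of the facility.
  have hbadle : ((Finset.univ.filter fun i => |x i - y a| ≤ r + η + η ∧
      σ * (x i - y a) < η).card : ℝ)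
      ≤ n * (μ.real (Iic h) - μ.real (Iic l) + 6 * M * η + δ) := by
    have hlh : l ≤ h := by rcases hσ with ⟨-, rfl, rfl⟩ | ⟨-, rfl, rfl⟩ <;> linarith
    have e1 : ((Finset.univ.filter fun i => |x i - y a| ≤ r + η + η ∧
        σ * (x i - y a) < η).card : ℝ)
        ≤ (Finset.univ.filter fun i => x i ∈ Icc (l - 3 * η) (h + 3 * η)).card := by
      refine Nat.cast_le.2 (Finset.card_le_card fun i hi => ?_)
      simp only [Finset.mem_filter, Finset.mem_univ, true_and, mem_Icc, abs_le] at hi ⊢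
      obtain ⟨⟨i1, i2⟩, i3⟩ := hi
      rcases hσ with ⟨rfl, rfl, rfl⟩ | ⟨rfl, rfl, rfl⟩ <;> constructor <;>
        linarith [hya'.1, hya'.2]
    have e2 := (abs_le.1 (hx.2 (l - 3 * η) (h + 3 * η) (by linarith))).2
    have e3 := hL (l - 3 * η) l (by linarith)
    have e4 := hL h (h + 3 * η) (by linarith)
    have e5 : μ.real (Iic (h + 3 * η)) - μ.real (Iic (l - 3 * η))
        ≤ μ.real (Iic h) - μ.real (Iic l) + 6 * M * η := by linarith
    nlinarith
  have hfl := Nat.lt_floor_add_one (q a * (n : ℝ))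
  have hgain := nashWelfare_add_le_of_separated (q := q) (tie := tie) hx.1 hyI hab
    hcap (ε := η) (R := r + η + η) (R' := r + η + 2 * η)
    (Q := s + η + η) (g := D / 4 * n) hσ' hη0 (by positivity)
    (by
      have ia := hyI a
      have ib := hyI b
      rcases hσ' with rfl | rfl <;> constructor <;>
        linarith [ia.1, ia.2, ib.1, ib.2])
    (h₃ _ _ hya) (h₃ _ _ hmoved) (h₄ _ _ hyb)
    -- The moved distance loses at most `3 * η` and the radii exceed `r + s` by `5 * η`, hence the
    -- factor `8` in `hηg`.
    (by
      have e1 : σ * (y b - (y a + σ * η))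
          ≤ |y a + σ * η - y b| := by
        rw [abs_sub_comm]
        refine (le_abs_self _).trans (le_of_eq ?_)
        rw [abs_mul]
        rcases hσ' with rfl | rfl <;> norm_num
      linarith)
    -- Of the imbalance `D`, the Lipschitz error takes at most `D / 4`, sampling `D / 4` and the
    -- floor `D / 4`; the remaining `D / 4` is the gain.
    (by
      have e1 : n * (6 * M * η) ≤ n * (D / 8) := by
        gcongr
        linarith
      have e2 : n * δ ≤ n * (D / 8) := by gcongr
      nlinarith)
  rwa [← mul_assoc] at hgain

/-- If a facility whose agents lie mostly on the side of the other one can be moved towards it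
without competing for agents, the mechanism is not asymptotically optimal. -/
theorem not_isAsymptoticallyOptimal_of_unbalanced (hμ : HasContinuousDensity μ f)
    (hc : c ∈ Icc (0 : ℝ) 1) (hinc : StrictMonoOn f (Icc 0 c)) (hdec : StrictAntiOn f (Icc c 1))
    {q : Fin 2 → ℝ} (hq : ∀ j, 0 < q j) (hq' : ∑ j, q j < 1)
    {tie : ∀ n : ℕ, Fin 2 → Equiv.Perm (Fin n)} {p : Fin 2 → ℝ} (hp : ∀ j, p j ∈ Icc (0 : ℝ) 1)
    {a b : Fin 2} (hab : a ≠ b) {α β r s : ℝ} (hα : α ∈ Icc (0 : ℝ) 1) (hβ : β ∈ Icc (0 : ℝ) 1)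
    (hr : 0 < r) (hs : 0 < s) (hαp : μ.real (Iic α) = p a) (hβp : μ.real (Iic β) = p b)
    (hra : μ.real (Iic (α + r)) - μ.real (Iic (α - r)) = q a)
    (hsb : μ.real (Iic (β + s)) - μ.real (Iic (β - s)) = q b) {σ l h : ℝ}
    (hσ : (σ = 1 ∧ l = α - r ∧ h = α) ∨ (σ = -1 ∧ l = α ∧ h = α + r))
    (hsep : r + s < σ * (β - α)) (hbal : 2 * (μ.real (Iic h) - μ.real (Iic l)) < q a) :
    ¬ IsAsymptoticallyOptimal μ q tie p := by
  obtain ⟨M, hM, hL⟩ := hμ.exists_lipschitz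
  rw [sum_fin_two_of_ne hab] at hq'
  have hqa : q a < 1 := by linarith [hq b]
  have hqb : q b < 1 := by linarith [hq a]
  obtain ⟨D, hD⟩ : ∃ D, D = q a - 2 * (μ.real (Iic h) - μ.real (Iic l)) := ⟨_, rfl⟩
  have hD0 : 0 < D := by linarith
  obtain ⟨η, hη0, hη⟩ := exists_between
    (lt_min (by positivity : 0 < D / (48 * M)) (by linarith : 0 < (σ * (β - α) - r - s) / 8))
  rw [lt_min_iff, lt_div_iff₀ (by positivity)] at hη
  obtain ⟨hηD, hηg⟩ := hη
  obtain ⟨δ₁, hδ₁, h₁⟩ := exists_percentileMechanism_near hμ hc hinc hdec (hp a) hα hαp hη0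
  obtain ⟨δ₂, hδ₂, h₂⟩ := exists_percentileMechanism_near hμ hc hinc hdec (hp b) hβ hβp hη0
  obtain ⟨δ₃, hδ₃, h₃⟩ := exists_floor_le_card_ball hμ hc hinc hdec hα hr hqa hra hη0
  obtain ⟨δ₄, hδ₄, h₄⟩ := exists_floor_le_card_ball hμ hc hinc hdec hβ hs hqb hsb hη0
  obtain ⟨δ, hδ0, hδ⟩ := exists_between (lt_min (lt_min (lt_min hδ₁ hδ₂) (lt_min hδ₃ hδ₄))
    (by positivity : 0 < D / 8))
  simp only [lt_min_iff] at hδ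
  obtain ⟨⟨⟨hδ1, hδ2⟩, hδ3, hδ4⟩, hδD⟩ := hδ
  refine not_isAsymptoticallyOptimal_of_gain hμ (κ := η * (D / 4)) (by positivity) hδ0 ?_
  obtain ⟨n₀, hn₀⟩ := exists_nat_gt (4 / D)
  filter_upwards [eventually_ge_atTop (n₀ + 1), h₁, h₂] with n hn h₁ h₂ x hx
  have hn0 : 0 < n := by omega
  have hnD : 4 < n * D := by
    rw [← div_lt_iff₀ hD0]
    exact hn₀.trans_le (by exact_mod_cast (by omega : n₀ ≤ n))
  have hya := h₁ x (hx.mono hδ1.le)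
  have hyb := h₂ x (hx.mono hδ2.le)
  exact hx.nashWelfare_add_le hL (fun j => percentileMechanism_mem_Icc hx.1 j) hab
    (floor_add_floor_lt (hq a) (hq b) hq' hn0).le hr hη0 hya hyb
    (fun z η' => h₃ n x (hx.mono hδ3.le) z η') (fun z η' => h₄ n x (hx.mono hδ4.le) z η') hσ hs hηg
    hηD hδD hD0 hD hnD

/-- If at least as many agents lie between the facilities as these can accommodate, the percentile
mechanism is not asymptotically optimal. -/
theorem not_isAsymptoticallyOptimal_of_le (hμ : HasContinuousDensity μ f)
    (hf : IsSinglePeakedDensity f) {q : Fin 2 → ℝ} (hq : ∀ j, 0 < q j) (hq' : ∑ j, q j < 1)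
    {tie : ∀ n : ℕ, Fin 2 → Equiv.Perm (Fin n)} {p : Fin 2 → ℝ} (hp : ∀ j, p j ∈ Icc (0 : ℝ) 1)
    {a b : Fin 2} (hab : a ≠ b) (hle : ∑ j, q j ≤ p b - p a) :
    ¬ IsAsymptoticallyOptimal μ q tie p := by
  obtain ⟨c, hc, hinc, hdec⟩ := hf
  have hsum := hq'
  rw [sum_fin_two_of_ne hab] at hsum hle
  obtain ⟨α, hα, hαp⟩ := hμ.exists_quantile (hp a)
  obtain ⟨β, hβ, hβp⟩ := hμ.exists_quantile (hp b)
  obtain ⟨r, hr, hra⟩ := hμ.exists_radius hα (hq a) (by linarith [hq b])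
  obtain ⟨s, hs, hsb⟩ := hμ.exists_radius hβ (hq b) (by linarith [hq a])
  have hsep := hμ.balls_separated hc hinc hdec hα hβ hr hs hra hsb hsum (by rw [hαp, hβp]; exact hle)
  -- The separated balls cannot both reach across the peak: either the one around `α` ends before
  -- `c`, or the one around `β` starts after it.
  rcases le_total (α + r) c with h | h
  · have hbal := hμ.measure_left_lt_right hc hinc hα.1 hr h
    exact not_isAsymptoticallyOptimal_of_unbalanced hμ hc hinc hdec hq hq' hp hab hα hβ hr hs hαp hβp
      hra hsb (Or.inl ⟨rfl, rfl, rfl⟩) (by linarith) (by linarith)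
  · have hbal := hμ.measure_right_lt_left hc hdec hβ.2 hs (by linarith : c ≤ β - s)
    exact not_isAsymptoticallyOptimal_of_unbalanced hμ hc hinc hdec hq hq' hp hab.symm hβ hα hs hr
      hβp hαp hsb hra (Or.inr ⟨rfl, rfl, rfl⟩) (by linarith) (by linarith)

end Single

end FLPSR

/-! ### The impossibility theorem -/

theorem mainTheorem10 (μ : MeasureTheory.Measure ℝ) (f : ℝ → ℝ)
    (hμ : FLPSR.HasContinuousDensity μ f)
    (hf : FLPSR.IsMonotoneDensity f ∨ FLPSR.IsSinglePeakedDensity f)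
    (q : Fin 2 → ℝ) (hq : ∀ j, 0 < q j) (hq' : ∑ j, q j < 1)
    (tie : ∀ n : ℕ, Fin 2 → Equiv.Perm (Fin n)) :
    ¬ ∃ p : Fin 2 → ℝ, (∀ j, p j ∈ Set.Icc (0 : ℝ) 1) ∧
      FLPSR.IsEquilibriumStable q tie p ∧ FLPSR.IsAsymptoticallyOptimal μ q tie p := by
  rintro ⟨p, hp, hstable, hopt⟩
  have hpeak : FLPSR.IsSinglePeakedDensity f :=
    hf.elim FLPSR.isSinglePeakedDensity_of_isMonotoneDensity id
  -- Both strict orders of the percentiles are excluded, by instability for a small gap and by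
  -- suboptimality for a large one; only coincident facilities remain.
  have hlt : ∀ a b : Fin 2, a ≠ b → ¬ p a < p b := by
    intro a b hab hpab
    rcases lt_or_ge (p b - p a) (∑ j, q j) with h | h
    · exact FLPSR.not_isEquilibriumStable_of_lt hq hq' hp hpab h hstable
    · exact FLPSR.not_isAsymptoticallyOptimal_of_le hμ hpeak hq hq' hp hab h hopt
  have heq : p 0 = p 1 :=
    le_antisymm (not_lt.1 (hlt 1 0 (by decide))) (not_lt.1 (hlt 0 1 (by decide)))
  exact FLPSR.not_isAsymptoticallyOptimal_of_eq hμ hq hq' (by decide) heq hopt
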